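/- A Steiner system $S(t,k,v)$ is a pair $(X,\mathcal B)$, where $X$ is a set of $v$ points and $\mathcal B$ is a collection of $k$-element subsets of $X$ (blocks) such that every $t$-element subset of $X$ is contained in exactly one block. A collection of blocks on a point set $X$ is resolvable if it can be partitioned into parallel classes, a parallel class being a set of blocks that forms a partition of $X$. The derived design of $(X,\mathcal B)$ at a point $x\in X$ is $(X\setminus\{x\},\{B\setminus\{x\} : x\in B\in\mathcal B\})$. An $\mathrm{RDSQS}(v)$ (a Steiner quadruple system with resolvable derived designs) is an $S(3,4,v)$ whose derived design at every point is resolvable. **Theorem.** For every integer $n\ge 0$ there exist an $\mathrm{RDSQS}(3\cdot 7^{n}+1)$ and an $\mathrm{RDSQS}(3\cdot 13^{n}+1)$. -/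

import Mathlib

open Finset

/-- `(X, B)` is a Steiner system `S(t, k, v)`: `X` is a set of `v` points, `B` is a collection of
`k`-element subsets of `X` (blocks), and every `t`-element subset of `X` is contained in exactly
one block. -/
structure IsSteinerSystem {α : Type*} (t k v : ℕ) (X : Finset α) (B : Finset (Finset α)) :
    Prop where
  card_points : #X = v
  block_subset : ∀ b ∈ B, b ⊆ X
  card_block : ∀ b ∈ B, #b = k
  existsUnique_block : ∀ T ⊆ X, #T = t → ∃! b, b ∈ B ∧ T ⊆ b

/-- `P` is a parallel class on the point set `X`: the blocks in `P` form a partition of `X`. -/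
def IsParallelClass {α : Type*} [DecidableEq α] (X : Finset α) (P : Finset (Finset α)) : Prop :=
  ∃ Q : Finpartition X, Q.parts = P

/-- The collection of blocks `B` on the point set `X` is resolvable: `B` can be partitioned into
parallel classes. -/
def IsResolvable {α : Type*} [DecidableEq α] (X : Finset α) (B : Finset (Finset α)) : Prop :=
  ∃ R : Finpartition B, ∀ P ∈ R.parts, IsParallelClass X P

/-- The blocks `{b \ {x} : x ∈ b ∈ B}` of the derived design at the point `x`. -/
def derivedBlocks {α : Type*} [DecidableEq α] (B : Finset (Finset α)) (x : α) :
    Finset (Finset α) :=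
  {b ∈ B | x ∈ b}.image fun b => b.erase x

/-- `(X, B)` is an `RDS(t, k, v)`: an `S(t, k, v)` whose derived design
`(X \ {x}, {b \ {x} : x ∈ b ∈ B})` at every point `x` is resolvable. -/
structure IsRDS {α : Type*} [DecidableEq α] (t k v : ℕ) (X : Finset α) (B : Finset (Finset α)) :
    Prop where
  isSteinerSystem : IsSteinerSystem t k v X B
  resolvable_derived : ∀ x ∈ X, IsResolvable (X.erase x) (derivedBlocks B x)

/-- `(X, B)` is an `RDSQS(v)`, a Steiner quadruple system on `v` points with resolvable derived
designs: an `RDS(3, 4, v)`. -/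
def IsRDSQS {α : Type*} [DecidableEq α] (v : ℕ) (X : Finset α) (B : Finset (Finset α)) : Prop :=
  IsRDS 3 4 v X B

/-- A resolvable `H`-design with block size four, whose groups are the fibres of `π`: every
transversal triple lies in a unique block, and at every point `x` the blocks through `x` are
coloured by `Fin m` such that each colour class partitions the points outside the group of `x`.
For injective `π` this is a quadruple system with resolvable derived designs. -/
structure IsResolvableHDesign {α ι : Type*} (π : α → ι) (m : ℕ) (B : Finset (Finset α)) :
    Prop where
  card_block : ∀ b ∈ B, #b = 4
  injOn_block : ∀ b ∈ B, Set.InjOn π (b : Set α)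
  cover : ∀ x y z, π x ≠ π y → π x ≠ π z → π y ≠ π z → ∃! b, b ∈ B ∧ x ∈ b ∧ y ∈ b ∧ z ∈ b
  resolution : ∀ x, ∃ col : Finset α → Fin m,
    ∀ y, π x ≠ π y → ∀ k, ∃! b, b ∈ B ∧ x ∈ b ∧ y ∈ b ∧ col b = k

/-- The conditions of `IsResolvableHDesign` at one point `x`. -/
def ResolvableAt {α ι : Type*} (π : α → ι) (m : ℕ) (B : Finset (Finset α)) (x : α) : Prop :=
  (∀ y z, π x ≠ π y → π x ≠ π z → π y ≠ π z → ∃! b, b ∈ B ∧ x ∈ b ∧ y ∈ b ∧ z ∈ b) ∧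
  ∃ col : Finset α → Fin m, ∀ y, π x ≠ π y → ∀ k, ∃! b, b ∈ B ∧ x ∈ b ∧ y ∈ b ∧ col b = k

/-- Resolvability at a point is transported along a bijection of points that identifies the groups
and the blocks. -/
theorem ResolvableAt.map {α β ι κ : Type*} {π : α → ι} {ρ : β → κ} {m : ℕ}
    {B : Finset (Finset α)} {C : Finset (Finset β)} (e : α ≃ β)
    (hπ : ∀ x y, ρ (e x) = ρ (e y) ↔ π x = π y)
    (hB : ∀ b, b.map e.toEmbedding ∈ C ↔ b ∈ B) {x : α} (h : ResolvableAt π m B x) :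
    ResolvableAt ρ m C (e x) := by
  have key : ∀ (p : Finset α → Prop), (∃! b, b ∈ B ∧ p b) →
      ∃! c, c ∈ C ∧ p (c.map e.symm.toEmbedding) := by
    rintro p ⟨b, ⟨hb, hp⟩, hu⟩
    have inv : ∀ c : Finset β, (c.map e.symm.toEmbedding).map e.toEmbedding = c := by
      intro c; ext y; simp
    refine ⟨b.map e.toEmbedding, ⟨(hB b).2 hb, ?_⟩, ?_⟩
    · convert hp; ext y; simp
    · rintro c ⟨hc, hpc⟩
      rw [← hu (c.map e.symm.toEmbedding) ⟨(hB _).1 (by rwa [inv]), hpc⟩, inv]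
  obtain ⟨h1, col, h2⟩ := h
  have hmem : ∀ (c : Finset β) (a : α), a ∈ c.map e.symm.toEmbedding ↔ e a ∈ c := by
    intro c a; simp
  refine ⟨fun y z hy hz hyz => ?_, fun c => col (c.map e.symm.toEmbedding), fun y hy k => ?_⟩
  · obtain ⟨y, rfl⟩ := e.surjective y
    obtain ⟨z, rfl⟩ := e.surjective z
    rw [Ne, hπ] at hy hz hyz
    simpa only [hmem] using key _ (h1 y z hy hz hyz)
  · obtain ⟨y, rfl⟩ := e.surjective y
    rw [Ne, hπ] at hy
    simpa only [hmem] using key _ (h2 y hy k)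

theorem IsResolvableHDesign.map {α β ι κ : Type*} {π : α → ι} {ρ : β → κ} {m : ℕ}
    {B : Finset (Finset α)} (h : IsResolvableHDesign π m B) (e : α ≃ β)
    (hπ : ∀ x y, ρ (e x) = ρ (e y) ↔ π x = π y) :
    IsResolvableHDesign ρ m (B.map (mapEmbedding e.toEmbedding).toEmbedding) := by
  have hB : ∀ b, b.map e.toEmbedding ∈ B.map (mapEmbedding e.toEmbedding).toEmbedding ↔ b ∈ B := by
    intro b
    rw [← mapEmbedding_apply]
    exact mem_map' (mapEmbedding e.toEmbedding).toEmbedding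
  have hR : ∀ y, ResolvableAt ρ m (B.map (mapEmbedding e.toEmbedding).toEmbedding) y := by
    intro y
    obtain ⟨x, rfl⟩ := e.surjective y
    exact ResolvableAt.map e hπ hB ⟨h.cover x, h.resolution x⟩
  refine ⟨?_, ?_, fun x => (hR x).1, fun x => (hR x).2⟩
  · simp only [mem_map, forall_exists_index, and_imp]
    rintro _ b hb rfl
    simpa using h.card_block b hb
  · simp only [mem_map, forall_exists_index, and_imp]
    rintro _ b hb rfl
    rintro x hx y hy hxy
    simp only [RelEmbedding.coe_toEmbedding, mapEmbedding_apply, coe_map, Equiv.coe_toEmbedding,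
      Set.mem_image, mem_coe] at hx hy
    obtain ⟨x, hx, rfl⟩ := hx
    obtain ⟨y, hy, rfl⟩ := hy
    rw [h.injOn_block b hb hx hy ((hπ x y).1 hxy)]

/-- A design on the points `0, …, N - 1` with groups the residue classes modulo `k`, presented by a
list of permutations `act p`, `p ∈ params`, generated by those with `p ∈ gens`, by base blocks, and
by resolutions of the derived designs at some points. -/
structure OrbitPresentation where
  N : ℕ
  k : ℕ
  m : ℕ
  act : ℕ × ℕ × ℕ → ℕ → ℕ
  mul : ℕ × ℕ × ℕ → ℕ × ℕ × ℕ → ℕ × ℕ × ℕ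
  params : List (ℕ × ℕ × ℕ)
  gens : List (ℕ × ℕ × ℕ)
  base : List (List ℕ)
  resolutions : List (ℕ × List (List (List ℕ)))

namespace OrbitPresentation

variable (d : OrbitPresentation)

/-- All images of the base blocks. -/
def orbit : List (List ℕ) := d.base.flatMap fun b => d.params.map fun p => b.map (d.act p)

/-- The set of points in a list. -/
def toBlock (l : List ℕ) : Finset (Fin d.N) := {i | (i : ℕ) ∈ l}

/-- The blocks of the presented design. -/
def blocks : Finset (Finset (Fin d.N)) := (d.orbit.map d.toBlock).toFinset

/-- The group of a point. -/
def group (i : Fin d.N) : ℕ := i % d.k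

/-- The characteristic bit vector of the set of entries of a list. -/
def mask (l : List ℕ) : ℕ := l.foldr (fun i s => s ||| 1 <<< i) 0

/-- The triples of a resolution, labelled with the index of their class. -/
def labelled (r : List (List (List ℕ))) : List (ℕ × List ℕ) :=
  r.zipIdx.flatMap fun c => c.1.map fun t => (c.2, t)

/-- Membership in a list of parameters, by comparison of the components. -/
def hasParam (l : List (ℕ × ℕ × ℕ)) (p : ℕ × ℕ × ℕ) : Bool :=
  l.any fun q => q.1.beq p.1 && q.2.1.beq p.2.1 && q.2.2.beq p.2.2

/-- Membership in a list of numbers. -/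
def hasNat (l : List ℕ) (i : ℕ) : Bool := l.any fun j => j.beq i

def checkOrbit : Bool :=
  (d.base.all fun b => b.all (· < d.N)) &&
    d.orbit.all fun b => b.length == 4 && b.all (· < d.N) && decide (b.map (· % d.k)).Nodup

def checkGens : Bool :=
  d.gens.all fun g =>
    ((List.range d.N).all fun i => d.act g i < d.N && (List.range d.N).all fun j =>
      ((d.act g i == d.act g j) == (i == j)) &&
      ((d.act g i % d.k == d.act g j % d.k) == (i % d.k == j % d.k))) &&
    d.params.all fun p => hasParam d.params (d.mul g p) &&
      (List.range d.N).all fun i => d.act g (d.act p i) == d.act (d.mul g p) i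

def checkReach : Bool :=
  (List.range d.N).all fun x => hasNat (d.resolutions.map Prod.fst) x ||
    (List.range x).any fun y => d.gens.any fun g => d.act g y == x

def checkPairs (x : ℕ) (E : List (ℕ × List ℕ)) : Bool :=
  (List.range d.N).all fun y => y % d.k == x % d.k ||
    ((List.range d.N).all fun z => z % d.k == x % d.k || z % d.k == y % d.k ||
      ((E.filter fun t => hasNat t.2 y).filter fun t => hasNat t.2 z).length == 1) &&
    (List.range d.m).all fun c =>
      ((E.filter fun t => hasNat t.2 y).filter fun t => t.1 == c).length == 1

def checkBlocks (x : ℕ) (E : List (ℕ × List ℕ)) : Bool :=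
  ((d.orbit.filter fun b => hasNat b x).all fun b =>
    hasNat (E.map fun t => mask (x :: t.2)) (mask b)) &&
  E.all fun t => hasNat ((d.orbit.filter fun b => hasNat b x).map mask) (mask (x :: t.2)) &&
    t.1 < d.m

def checkAt (r : ℕ × List (List (List ℕ))) : Bool :=
  d.checkPairs r.1 (labelled r.2) && d.checkBlocks r.1 (labelled r.2)

def check : Bool :=
  d.checkOrbit && d.checkGens && d.checkReach && d.resolutions.all d.checkAt

end OrbitPresentation

namespace OrbitPresentation

variable (d : OrbitPresentation)

theorem mem_toBlock {l : List ℕ} {i : Fin d.N} : i ∈ d.toBlock l ↔ (i : ℕ) ∈ l := by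
  simp [toBlock]

theorem mem_blocks {b : Finset (Fin d.N)} : b ∈ d.blocks ↔ ∃ l ∈ d.orbit, d.toBlock l = b := by
  simp [blocks]

theorem testBit_mask (l : List ℕ) (i : ℕ) : (mask l).testBit i = decide (i ∈ l) := by
  induction l with
  | nil => simp [mask]
  | cons a l ih =>
    have : mask (a :: l) = mask l ||| 1 <<< a := rfl
    rw [this, Nat.testBit_or, ih, Nat.one_shiftLeft, Nat.testBit_two_pow]
    by_cases h : a = i <;> simp [h, eq_comm]
    grind

theorem mem_iff_of_mask_eq {l l' : List ℕ} (h : mask l = mask l') (i : ℕ) : i ∈ l ↔ i ∈ l' := by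
  have := testBit_mask l i
  rw [h, testBit_mask] at this
  simpa using this.symm

theorem toBlock_eq_of_mask_eq {l l' : List ℕ} (h : mask l = mask l') :
    d.toBlock l = d.toBlock l' := by
  ext i
  simp only [mem_toBlock, mem_iff_of_mask_eq h]

theorem existsUnique_of_length_filter {α : Type*} {l : List α} {p : α → Bool}
    (h : (l.filter p).length = 1) : ∃ a ∈ l, p a ∧ ∀ b ∈ l, p b → b = a := by
  obtain ⟨a, ha⟩ := List.length_eq_one_iff.1 h
  have hm : ∀ b, (b ∈ l ∧ p b) ↔ b = a := fun b => by
    rw [← List.mem_filter, ha, List.mem_singleton]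
  exact ⟨a, ((hm a).2 rfl).1, ((hm a).2 rfl).2, fun b hb hp => (hm b).1 ⟨hb, hp⟩⟩

theorem hasNat_iff {l : List ℕ} {i : ℕ} : hasNat l i = true ↔ i ∈ l := by
  simp [hasNat, Nat.beq_eq]

theorem mem_of_hasParam {l : List (ℕ × ℕ × ℕ)} {p : ℕ × ℕ × ℕ} (h : hasParam l p = true) :
    p ∈ l := by
  simp only [hasParam, List.any_eq_true, Bool.and_eq_true, Nat.beq_eq] at h
  obtain ⟨⟨a, b, c⟩, hq, ⟨h1, h2⟩, h3⟩ := h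
  simp only at h1 h2 h3
  subst h1 h2 h3
  exact hq

variable {d}

theorem resolvableAt_of_checkAt {r : ℕ × List (List (List ℕ))} (h : d.checkAt r = true)
    (hm : 0 < d.m) (hx : r.1 < d.N) (h4 : ∀ b ∈ d.blocks, #b = 4)
    (hinj : ∀ b ∈ d.blocks, Set.InjOn d.group (b : Set (Fin d.N))) :
    ResolvableAt d.group d.m d.blocks ⟨r.1, hx⟩ := by
  obtain ⟨x, r⟩ := r
  simp only at hx
  generalize hE : labelled r = E at *
  simp only [checkAt, hE, checkPairs, checkBlocks, Bool.and_eq_true, List.all_eq_true,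
    List.mem_range, Bool.or_eq_true, beq_iff_eq, decide_eq_true_eq, hasNat_iff,
    List.mem_map, List.mem_filter] at h
  obtain ⟨hp, hO, hD⟩ := h
  -- blocks through `x` are the lists `x :: t`
  have h1 : ∀ b ∈ d.blocks, (⟨x, hx⟩ : Fin d.N) ∈ b → ∃ t ∈ E, b = d.toBlock (x :: t.2) := by
    intro b hb hxb
    obtain ⟨l, hl, rfl⟩ := d.mem_blocks.1 hb
    obtain ⟨t, ht, e⟩ := hO l ⟨hl, d.mem_toBlock.1 hxb⟩
    exact ⟨t, ht, d.toBlock_eq_of_mask_eq e.symm⟩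
  have h2 : ∀ t ∈ E, d.toBlock (x :: t.2) ∈ d.blocks := by
    intro t ht
    obtain ⟨l, ⟨hl, _⟩, e⟩ := (hD t ht).1
    exact d.mem_blocks.2 ⟨l, hl, d.toBlock_eq_of_mask_eq e⟩
  have hmem : ∀ (y : Fin d.N), d.group ⟨x, hx⟩ ≠ d.group y → ∀ t : ℕ × List ℕ,
      (y ∈ d.toBlock (x :: t.2) ↔ (y : ℕ) ∈ t.2) := by
    intro y hy t
    rw [mem_toBlock, List.mem_cons, or_iff_right]
    rintro h
    exact hy (by simp [group, h])
  have hxm : ∀ t : ℕ × List ℕ, (⟨x, hx⟩ : Fin d.N) ∈ d.toBlock (x :: t.2) := by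
    intro t; simp [mem_toBlock]
  have hpair : ∀ y z : Fin d.N, d.group ⟨x, hx⟩ ≠ d.group y → d.group ⟨x, hx⟩ ≠ d.group z →
      d.group y ≠ d.group z → ∃ t ∈ E, ((y : ℕ) ∈ t.2 ∧ (z : ℕ) ∈ t.2) ∧
        ∀ s ∈ E, (y : ℕ) ∈ s.2 → (z : ℕ) ∈ s.2 → s = t := by
    intro y z hy hz hyz
    have := (((hp y y.2).resolve_left (fun h => hy h.symm)).1 z z.2).resolve_left
      (not_or.2 ⟨fun h => hz h.symm, fun h => hyz h.symm⟩)
    rw [List.filter_filter] at this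
    obtain ⟨t, ht, hpt, hu⟩ := existsUnique_of_length_filter this
    simp only [Bool.and_eq_true, hasNat_iff] at hpt hu
    exact ⟨t, ht, hpt.symm, fun s hs h1 h2 => hu s hs ⟨h2, h1⟩⟩
  have hcol : ∀ y : Fin d.N, d.group ⟨x, hx⟩ ≠ d.group y → ∀ k < d.m, ∃ t ∈ E,
      ((y : ℕ) ∈ t.2 ∧ t.1 = k) ∧ ∀ s ∈ E, (y : ℕ) ∈ s.2 → s.1 = k → s = t := by
    intro y hy k hk
    have := ((hp y y.2).resolve_left (fun h => hy h.symm)).2 k hk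
    rw [List.filter_filter] at this
    obtain ⟨t, ht, hpt, hu⟩ := existsUnique_of_length_filter this
    simp only [Bool.and_eq_true, hasNat_iff, beq_iff_eq] at hpt hu
    exact ⟨t, ht, hpt.symm, fun s hs h1 h2 => hu s hs ⟨h2, h1⟩⟩
  have huniq : ∀ t ∈ E, ∀ s ∈ E, d.toBlock (x :: t.2) = d.toBlock (x :: s.2) → t = s := by
    intro t ht s hs hts
    have hb := h2 t ht
    obtain ⟨y, hy, z, hz, hyz⟩ := one_lt_card.1 (show 1 < #((d.toBlock (x :: t.2)).erase ⟨x, hx⟩) by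
      rw [card_erase_of_mem (hxm t), h4 _ hb]; norm_num)
    rw [mem_erase] at hy hz
    have hy' := (hinj _ hb).ne (hxm t) hy.2 hy.1.symm
    have hz' := (hinj _ hb).ne (hxm t) hz.2 hz.1.symm
    obtain ⟨w, -, -, hw⟩ := hpair y z hy' hz' ((hinj _ hb).ne hy.2 hz.2 hyz)
    rw [hw t ht ((hmem y hy' t).1 hy.2) ((hmem z hz' t).1 hz.2),
      hw s hs ((hmem y hy' s).1 (hts ▸ hy.2)) ((hmem z hz' s).1 (hts ▸ hz.2))]
  refine ⟨fun y z hy hz hyz => ?_, ?_⟩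
  · obtain ⟨t, ht, ⟨hyt, hzt⟩, hu⟩ := hpair y z hy hz hyz
    refine ⟨_, ⟨h2 t ht, hxm t, (hmem y hy t).2 hyt, (hmem z hz t).2 hzt⟩, ?_⟩
    rintro b ⟨hb, hxb, hyb, hzb⟩
    obtain ⟨s, hs, rfl⟩ := h1 b hb hxb
    rw [hu s hs ((hmem y hy s).1 hyb) ((hmem z hz s).1 hzb)]
  · have hlab : ∀ b : Finset (Fin d.N), ∃ k : Fin d.m,
        ∀ t ∈ E, b = d.toBlock (x :: t.2) → t.1 = k := by
      intro b
      by_cases hb : ∃ t ∈ E, b = d.toBlock (x :: t.2)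
      · obtain ⟨t, ht, rfl⟩ := hb
        exact ⟨⟨t.1, (hD t ht).2⟩, fun s hs hts => congrArg Prod.fst (huniq s hs t ht hts.symm)⟩
      · exact ⟨⟨0, hm⟩, fun t ht h => (hb ⟨t, ht, h⟩).elim⟩
    choose col hc using hlab
    refine ⟨col, fun y hy k => ?_⟩
    obtain ⟨t, ht, ⟨hyt, htk⟩, hu⟩ := hcol y hy k k.2
    refine ⟨_, ⟨h2 t ht, hxm t, (hmem y hy t).2 hyt, Fin.ext ?_⟩, ?_⟩
    · rw [← hc _ t ht rfl, htk]
    · rintro b ⟨hb, hxb, hyb, rfl⟩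
      obtain ⟨s, hs, rfl⟩ := h1 b hb hxb
      rw [hu s hs ((hmem y hy s).1 hyb) (hc _ s hs rfl)]

theorem isResolvableHDesign_of_check (h : d.check = true) (hm : 0 < d.m) :
    IsResolvableHDesign d.group d.m d.blocks := by
  simp only [check, Bool.and_eq_true] at h
  obtain ⟨⟨⟨hO, hG⟩, hR⟩, hA⟩ := h
  simp only [checkOrbit, List.all_eq_true, Bool.and_eq_true, beq_iff_eq, decide_eq_true_eq] at hO
  simp only [checkGens, List.all_eq_true, Bool.and_eq_true, beq_iff_eq, decide_eq_true_eq,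
    List.mem_range] at hG
  simp only [checkReach, List.all_eq_true, Bool.or_eq_true, List.any_eq_true, beq_iff_eq,
    List.mem_range, hasNat_iff, List.mem_map] at hR
  have hinj : ∀ b ∈ d.blocks, Set.InjOn d.group (b : Set (Fin d.N)) := by
    intro b hb i hi j hj hij
    obtain ⟨l, hl, rfl⟩ := d.mem_blocks.1 hb
    exact Fin.ext (List.inj_on_of_nodup_map (hO.2 l hl).2 (d.mem_toBlock.1 hi) (d.mem_toBlock.1 hj)
      hij)
  have h4 : ∀ b ∈ d.blocks, #b = 4 := by
    intro b hb
    obtain ⟨l, hl, rfl⟩ := d.mem_blocks.1 hb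
    rw [← (hO.2 l hl).1.1, ← List.toFinset_card_of_nodup (List.Nodup.of_map _ (hO.2 l hl).2),
      ← card_map Fin.valEmbedding]
    congr 1
    ext i
    simp only [mem_map, mem_toBlock, Fin.valEmbedding_apply, List.mem_toFinset]
    exact ⟨fun ⟨j, hj, e⟩ => e ▸ hj, fun hi => ⟨⟨i, (hO.2 l hl).1.2 i hi⟩, hi, rfl⟩⟩
  have hgen : ∀ g ∈ d.gens, ∃ e : Fin d.N ≃ Fin d.N, (∀ i, (e i : ℕ) = d.act g i) ∧
      ∀ i, ResolvableAt d.group d.m d.blocks i → ResolvableAt d.group d.m d.blocks (e i) := by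
    intro g hg
    obtain ⟨h1, h2⟩ := hG g hg
    let f : Fin d.N → Fin d.N := fun i => ⟨d.act g i, (h1 i i.2).1⟩
    have hf : Function.Injective f := fun i j hij => by
      have := ((h1 i i.2).2 j j.2).1
      rw [Fin.mk.injEq] at hij
      exact Fin.ext (by simpa [hij] using this)
    let e := Equiv.ofBijective f (Finite.injective_iff_bijective.1 hf)
    refine ⟨e, fun i => rfl, fun i hi => hi.map e (fun x y => ?_) ?_⟩
    · have := ((h1 x x.2).2 y y.2).2
      change d.act g x % d.k = d.act g y % d.k ↔ (x : ℕ) % d.k = y % d.k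
      rw [Bool.eq_iff_iff] at this
      simpa using this
    · have hsub : ∀ b ∈ d.blocks, b.map e.toEmbedding ∈ d.blocks := by
        intro b hb
        obtain ⟨l, hl, rfl⟩ := d.mem_blocks.1 hb
        have hl' := hl
        simp only [orbit, List.mem_flatMap, List.mem_map] at hl'
        obtain ⟨c, hc, p, hp, rfl⟩ := hl'
        have hcN : ∀ i ∈ c, i < d.N := fun i hi => hO.1 c hc i hi
        rw [mem_blocks]
        refine ⟨c.map (d.act (d.mul g p)), ?_, ?_⟩
        · simp only [orbit, List.mem_flatMap, List.mem_map]
          exact ⟨c, hc, _, (mem_of_hasParam (h2 p hp).1), rfl⟩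
        · ext i
          simp only [mem_toBlock, List.mem_map, mem_map, Equiv.coe_toEmbedding]
          constructor
          · rintro ⟨j, hj, hji⟩
            have hlt : d.act p j < d.N :=
              (hO.2 _ hl).1.2 _ (List.mem_map_of_mem hj)
            refine ⟨⟨d.act p j, hlt⟩, ⟨j, hj, rfl⟩, Fin.ext ?_⟩
            rw [← hji, ← (h2 p hp).2 j (hcN j hj)]
            rfl
          · rintro ⟨a, ⟨j, hj, hja⟩, rfl⟩
            refine ⟨j, hj, ?_⟩
            rw [← (h2 p hp).2 j (hcN j hj), hja]
            rfl
      have himg : d.blocks.map (mapEmbedding e.toEmbedding).toEmbedding = d.blocks := by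
        refine eq_of_subset_of_card_le ?_ (card_map _).ge
        simp only [subset_iff, mem_map, forall_exists_index, and_imp]
        rintro _ b hb rfl
        exact hsub b hb
      intro b
      refine ⟨fun hb => ?_, hsub b⟩
      rw [← himg, ← mapEmbedding_apply] at hb
      exact (mem_map' (mapEmbedding e.toEmbedding).toEmbedding).1 hb
  have hall : ∀ n (hn : n < d.N), ResolvableAt d.group d.m d.blocks ⟨n, hn⟩ := by
    intro n
    induction n using Nat.strong_induction_on with
    | _ n ih =>
      intro hn
      rcases hR n hn with ⟨r, hr, rfl⟩ | ⟨y, hy, g, hg, rfl⟩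
      · exact resolvableAt_of_checkAt (List.all_eq_true.1 hA r hr) hm hn h4 hinj
      · obtain ⟨e, he, hres⟩ := hgen g hg
        have := hres _ (ih y hy (hy.trans hn))
        have e1 : e ⟨y, hy.trans hn⟩ = ⟨d.act g y, hn⟩ := Fin.ext (he _)
        rwa [e1] at this
  exact ⟨h4, hinj, fun x => (hall x x.2).1, fun x => (hall x x.2).2⟩

end OrbitPresentation

namespace OrbitPresentation

/-- An `H`-design with `8` groups of size `3`, invariant under `(ℤ/2)³ × ℤ/3`. -/
def hDesignEight : OrbitPresentation where
  N := 24
  k := 8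
  m := 9
  act := fun p i => (i % 8 ^^^ p.2.1) + 8 * ((i / 8 + p.2.2) % 3)
  mul := fun p q => (0, p.2.1 ^^^ q.2.1, (p.2.2 + q.2.2) % 3)
  params := (List.range 8).flatMap fun t => (List.range 3).map fun s => (0, t, s)
  gens := [(0, 1, 0), (0, 2, 0), (0, 4, 0), (0, 0, 1)]
  base :=
    [[0, 5, 10, 23], [0, 3, 12, 18], [0, 3, 4, 10], [0, 4, 11, 18], [0, 6, 9, 18], [0, 1, 14, 18],
    [0, 7, 10, 13], [0, 1, 6, 10], [0, 1, 12, 21], [0, 4, 9, 13], [0, 6, 11, 21], [0, 3, 13, 14],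
    [0, 2, 13, 15], [0, 2, 4, 19], [0, 1, 2, 22], [0, 2, 5, 7], [0, 3, 5, 6], [0, 1, 4, 5], [0, 5,
    11, 14], [0, 2, 9, 14], [0, 5, 9, 12]]
  resolutions := [
    (0,
    [[[1, 2, 22], [3, 12, 18], [4, 6, 23], [5, 17, 20], [7, 10, 13], [9, 11, 15], [14, 19, 21]],
    [[1, 3, 23], [2, 4, 19], [5, 9, 12], [6, 15, 20], [7, 18, 21], [10, 14, 17], [11, 13, 22]],
    [[1, 4, 5], [2, 3, 20], [6, 11, 21], [7, 17, 19], [9, 10, 22], [12, 14, 15], [13, 18, 23]],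
    [[1, 6, 10], [2, 21, 23], [3, 7, 9], [4, 15, 22], [5, 11, 14], [12, 13, 17], [18, 19, 20]],
    [[1, 7, 11], [2, 6, 17], [3, 21, 22], [4, 9, 13], [5, 15, 18], [10, 12, 19], [14, 20, 23]],
    [[1, 12, 21], [2, 9, 14], [3, 15, 17], [4, 11, 18], [5, 10, 23], [6, 13, 19], [7, 20, 22]],
    [[1, 13, 20], [2, 11, 12], [3, 5, 6], [4, 7, 14], [9, 19, 23], [10, 15, 21], [17, 18, 22]],
    [[1, 14, 18], [2, 13, 15], [3, 4, 10], [5, 19, 22], [6, 7, 12], [9, 20, 21], [11, 17, 23]],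
    [[1, 15, 19], [2, 5, 7], [3, 13, 14], [4, 17, 21], [6, 9, 18], [10, 11, 20], [12, 22, 23]]])]

theorem check_hDesignEight : hDesignEight.check = true := by decide +kernel

/-- An `H`-design with `14` groups of size `3`, invariant under `(ℤ/14 ⋊ {±1}) × ℤ/3`. -/
def hDesignFourteen : OrbitPresentation where
  N := 42
  k := 14
  m := 18
  act := fun p i => (p.1 * (i % 14) + p.2.1) % 14 + 14 * ((i / 14 + p.2.2) % 3)
  mul := fun p q => (p.1 * q.1 % 14, (p.1 * q.2.1 + p.2.1) % 14, (p.2.2 + q.2.2) % 3)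
  params := [1, 13].flatMap fun e => (List.range 14).flatMap fun t => (List.range 3).map fun s => (e, t, s)
  gens := [(1, 1, 0), (13, 0, 0), (1, 0, 1)]
  base :=
    [[0, 6, 17, 38], [0, 6, 24, 31], [0, 3, 6, 10], [0, 1, 2, 36], [0, 2, 8, 29], [0, 2, 15, 22],
    [0, 2, 4, 9], [0, 4, 23, 30], [0, 4, 16, 37], [0, 2, 6, 21], [0, 2, 32, 37], [0, 2, 20, 31],
    [0, 2, 5, 17], [0, 2, 18, 33], [0, 1, 3, 39], [0, 2, 19, 25], [0, 4, 21, 34], [0, 1, 5, 40],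
    [0, 1, 21, 41], [0, 3, 18, 21], [0, 3, 20, 25], [0, 4, 15, 33], [0, 1, 4, 24], [0, 3, 8, 40],
    [0, 5, 20, 32], [0, 6, 23, 29], [0, 3, 19, 26], [0, 1, 17, 26], [0, 7, 16, 32], [0, 4, 29, 36],
    [0, 3, 29, 37], [0, 4, 20, 26], [0, 1, 6, 16], [0, 5, 22, 41], [0, 1, 18, 34], [0, 1, 20, 38],
    [0, 1, 7, 8]]
  resolutions := [
    (0,
    [[[1, 7, 8], [2, 18, 33], [3, 13, 23], [4, 29, 36], [5, 25, 34], [6, 24, 31], [9, 19, 21], [10,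
    16, 22], [11, 35, 38], [12, 20, 27], [15, 17, 39], [26, 30, 37], [32, 40, 41]], [[1, 10, 31],
    [2, 7, 12], [3, 30, 36], [4, 13, 39], [5, 24, 26], [6, 23, 29], [8, 19, 41], [9, 16, 18], [11,
    34, 40], [15, 20, 37], [17, 25, 35], [21, 32, 38], [22, 27, 33]], [[1, 5, 40], [2, 8, 29], [3,
    7, 11], [4, 31, 38], [6, 12, 41], [9, 13, 30], [10, 32, 39], [15, 16, 36], [17, 18, 20], [19,
    23, 35], [21, 33, 37], [22, 24, 25], [26, 27, 34]], [[1, 13, 35], [2, 20, 31], [3, 19, 26], [4,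
    7, 10], [5, 27, 29], [6, 17, 38], [8, 25, 32], [9, 15, 41], [11, 16, 23], [12, 22, 39], [18,
    36, 37], [21, 30, 40], [24, 33, 34]], [[1, 4, 24], [2, 19, 25], [3, 38, 41], [5, 7, 9], [6, 36,
    40], [8, 30, 34], [10, 13, 18], [11, 29, 32], [12, 17, 23], [15, 21, 27], [16, 26, 35], [20,
    33, 39], [22, 31, 37]], [[1, 11, 19], [2, 15, 22], [3, 32, 35], [4, 20, 26], [5, 21, 23], [6,
    7, 13], [8, 18, 39], [9, 17, 36], [10, 34, 41], [12, 24, 37], [16, 33, 40], [25, 27, 31], [29,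
    30, 38]], [[1, 6, 16], [2, 35, 40], [3, 9, 33], [4, 17, 41], [5, 30, 31], [7, 15, 25], [8, 12,
    21], [10, 11, 20], [13, 22, 32], [18, 23, 26], [19, 27, 36], [24, 29, 39], [34, 37, 38]], [[1,
    17, 26], [2, 10, 23], [3, 12, 15], [4, 21, 34], [5, 22, 41], [6, 37, 39], [7, 16, 32], [8, 9,
    24], [11, 13, 31], [18, 27, 40], [19, 20, 30], [25, 36, 38], [29, 33, 35]], [[1, 20, 38], [2,
    6, 21], [3, 4, 22], [5, 11, 37], [7, 17, 27], [8, 13, 26], [9, 39, 40], [10, 25, 29], [12, 30,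
    35], [15, 23, 34], [16, 19, 24], [18, 31, 41], [32, 33, 36]], [[1, 23, 33], [2, 24, 41], [3,
    20, 25], [4, 5, 35], [6, 15, 26], [7, 18, 22], [8, 17, 37], [9, 31, 34], [10, 19, 40], [11, 12,
    36], [13, 21, 29], [16, 38, 39], [27, 30, 32]], [[1, 2, 36], [3, 29, 37], [4, 6, 27], [5, 8,
    38], [7, 19, 31], [9, 12, 25], [10, 26, 33], [11, 15, 18], [13, 20, 40], [16, 17, 21], [22, 34,
    35], [23, 24, 32], [30, 39, 41]], [[1, 21, 41], [2, 3, 34], [4, 23, 30], [5, 36, 39], [6, 25,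
    33], [7, 20, 24], [8, 16, 27], [9, 10, 35], [11, 17, 22], [12, 18, 29], [13, 19, 37], [15, 38,
    40], [26, 31, 32]], [[1, 22, 30], [2, 5, 17], [3, 24, 27], [4, 16, 37], [6, 9, 32], [7, 23,
    39], [8, 10, 15], [11, 33, 41], [12, 13, 34], [18, 19, 38], [20, 35, 36], [21, 25, 26], [29,
    31, 40]], [[1, 3, 39], [2, 11, 27], [4, 12, 19], [5, 6, 18], [7, 26, 38], [8, 31, 33], [9, 20,
    29], [10, 21, 36], [13, 16, 25], [15, 24, 30], [17, 32, 34], [22, 23, 40], [35, 37, 41]], [[1,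
    12, 32], [2, 13, 38], [3, 5, 16], [4, 15, 33], [6, 8, 35], [7, 29, 41], [9, 11, 26], [10, 27,
    37], [17, 24, 40], [18, 25, 30], [19, 34, 39], [20, 21, 22], [23, 31, 36]], [[1, 18, 34], [2,
    32, 37], [3, 6, 10], [4, 25, 40], [5, 13, 15], [7, 30, 33], [8, 20, 23], [9, 22, 38], [11, 21,
    24], [12, 16, 31], [17, 19, 29], [26, 36, 41], [27, 35, 39]], [[1, 25, 37], [2, 4, 9], [3, 8,
    40], [5, 10, 12], [6, 11, 30], [7, 34, 36], [13, 17, 33], [15, 19, 32], [16, 20, 41], [18, 24,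
    35], [21, 31, 39], [22, 26, 29], [23, 27, 38]], [[1, 9, 27], [2, 26, 39], [3, 18, 21], [4, 8,
    11], [5, 20, 32], [6, 19, 22], [7, 37, 40], [10, 17, 30], [12, 33, 38], [13, 24, 36], [15, 31,
    35], [16, 29, 34], [23, 25, 41]]])]

theorem check_hDesignFourteen : hDesignFourteen.check = true := by decide +kernel

/-- A quadruple system on `22` points, invariant under `ℤ/7 × ℤ/3`. -/
def quadrupleSystem22 : OrbitPresentation where
  N := 22
  k := 22
  m := 10
  act := fun p i => if i < 21 then (i % 7 + p.2.1) % 7 + 7 * ((i / 7 + p.2.2) % 3) else i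
  mul := fun p q => (0, (p.2.1 + q.2.1) % 7, (p.2.2 + q.2.2) % 3)
  params := (List.range 7).flatMap fun t => (List.range 3).map fun s => (0, t, s)
  gens := [(0, 1, 0), (0, 0, 1)]
  base :=
    [[0, 7, 14, 21], [0, 1, 3, 21], [0, 8, 17, 21], [0, 10, 15, 21], [0, 1, 11, 20], [0, 1, 8, 10],
    [0, 2, 11, 17], [0, 2, 9, 13], [0, 1, 9, 12], [0, 1, 14, 17], [0, 1, 2, 19], [0, 1, 4, 13], [0,
    2, 7, 16], [0, 1, 5, 16], [0, 1, 7, 15], [0, 2, 12, 15], [0, 2, 4, 10], [0, 3, 11, 16], [0, 3,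
    10, 14]]
  resolutions := [
    (0,
    [[[1, 3, 21], [2, 5, 8], [4, 14, 19], [6, 7, 9], [10, 16, 18], [11, 13, 15], [12, 17, 20]],
    [[1, 4, 13], [2, 6, 21], [3, 11, 16], [5, 10, 20], [7, 12, 19], [8, 14, 15], [9, 17, 18]], [[1,
    9, 12], [2, 7, 16], [3, 10, 14], [4, 5, 21], [6, 8, 11], [13, 17, 19], [15, 18, 20]], [[1, 8,
    10], [2, 9, 13], [3, 15, 17], [4, 11, 12], [5, 18, 19], [6, 16, 20], [7, 14, 21]], [[1, 5, 16],
    [2, 12, 15], [3, 19, 20], [4, 7, 18], [6, 13, 14], [8, 17, 21], [9, 10, 11]], [[1, 14, 17], [2,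
    4, 10], [3, 6, 12], [5, 7, 11], [8, 13, 18], [9, 20, 21], [15, 16, 19]], [[1, 2, 19], [3, 4,
    9], [5, 6, 17], [7, 13, 20], [8, 12, 16], [10, 15, 21], [11, 14, 18]], [[1, 6, 18], [2, 14,
    20], [3, 7, 8], [4, 16, 17], [5, 9, 15], [10, 12, 13], [11, 19, 21]], [[1, 7, 15], [2, 11, 17],
    [3, 5, 13], [4, 8, 20], [6, 10, 19], [9, 14, 16], [12, 18, 21]], [[1, 11, 20], [2, 3, 18], [4,
    6, 15], [5, 12, 14], [7, 10, 17], [8, 9, 19], [13, 16, 21]]]),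
    (21,
    [[[0, 1, 3], [2, 10, 19], [4, 9, 15], [5, 11, 14], [6, 7, 16], [8, 12, 13], [17, 18, 20]], [[0,
    2, 6], [1, 9, 18], [3, 8, 14], [4, 13, 17], [5, 10, 16], [7, 11, 12], [15, 19, 20]], [[0, 4,
    5], [1, 10, 14], [2, 8, 18], [3, 11, 20], [6, 12, 15], [7, 9, 13], [16, 17, 19]], [[0, 7, 14],
    [1, 8, 15], [2, 9, 16], [3, 10, 17], [4, 11, 18], [5, 12, 19], [6, 13, 20]], [[0, 8, 17], [1,
    12, 20], [2, 3, 5], [4, 7, 19], [6, 9, 14], [10, 11, 13], [15, 16, 18]], [[0, 9, 20], [1, 2,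
    4], [3, 12, 16], [5, 13, 15], [6, 11, 17], [7, 8, 10], [14, 18, 19]], [[0, 10, 15], [1, 13,
    19], [2, 12, 17], [3, 4, 6], [5, 7, 18], [8, 9, 11], [14, 16, 20]], [[0, 11, 19], [1, 5, 6],
    [2, 7, 20], [3, 13, 18], [4, 8, 16], [9, 10, 12], [14, 15, 17]], [[0, 12, 18], [1, 11, 16], [2,
    13, 14], [3, 7, 15], [4, 10, 20], [5, 9, 17], [6, 8, 19]], [[0, 13, 16], [1, 7, 17], [2, 11,
    15], [3, 9, 19], [4, 12, 14], [5, 8, 20], [6, 10, 18]]])]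

theorem check_quadrupleSystem22 : quadrupleSystem22.check = true := by decide +kernel

/-- A quadruple system on `40` points, invariant under `(ℤ/19 ⋊ ℤ/9) × ℤ/2`. -/
def quadrupleSystem40 : OrbitPresentation where
  N := 40
  k := 40
  m := 19
  act := fun p i =>
    if i < 38 then (p.1 * (i % 19) + p.2.1) % 19 + 19 * ((i / 19 + p.2.2) % 2)
    else 38 + (i + p.2.2) % 2
  mul := fun p q => (p.1 * q.1 % 19, (p.1 * q.2.1 + p.2.1) % 19, (p.2.2 + q.2.2) % 2)
  params := [1, 4, 16, 7, 9, 17, 11, 6, 5].flatMap fun e =>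
    (List.range 19).flatMap fun t => (List.range 2).map fun s => (e, t, s)
  gens := [(1, 1, 0), (4, 0, 0), (1, 0, 1)]
  base :=
    [[0, 19, 38, 39], [0, 1, 8, 38], [0, 1, 12, 36], [0, 1, 21, 39], [0, 1, 19, 20], [0, 1, 3, 33],
    [0, 1, 2, 6], [0, 1, 25, 31], [0, 1, 22, 32], [0, 1, 27, 30]]
  resolutions := [
    (0,
    [[[1, 8, 38], [2, 19, 21], [3, 4, 16], [5, 7, 13], [6, 9, 24], [10, 20, 31], [11, 22, 39], [12,
    30, 32], [14, 25, 36], [15, 27, 29], [17, 26, 33], [18, 28, 34], [23, 35, 37]], [[1, 4, 15],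
    [2, 5, 38], [3, 27, 36], [6, 8, 16], [7, 11, 25], [9, 32, 35], [10, 19, 29], [12, 22, 24], [13,
    28, 30], [14, 26, 37], [17, 34, 39], [18, 21, 31], [20, 23, 33]], [[1, 7, 28], [2, 20, 27], [3,
    17, 38], [4, 24, 29], [5, 9, 12], [6, 11, 13], [8, 22, 37], [10, 23, 26], [14, 31, 35], [15,
    19, 34], [16, 32, 39], [18, 33, 36], [21, 25, 30]], [[1, 9, 14], [2, 23, 29], [3, 21, 32], [4,
    13, 38], [5, 17, 20], [6, 31, 39], [7, 12, 16], [8, 19, 27], [10, 25, 33], [11, 28, 37], [15,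
    22, 36], [18, 24, 30], [26, 34, 35]], [[1, 5, 18], [2, 4, 11], [3, 25, 34], [6, 10, 38], [7,
    23, 27], [8, 26, 36], [9, 37, 39], [12, 19, 31], [13, 33, 35], [14, 22, 29], [15, 21, 28], [16,
    17, 30], [20, 24, 32]], [[1, 21, 39], [2, 9, 17], [3, 23, 24], [4, 6, 35], [5, 22, 30], [7, 18,
    38], [8, 20, 34], [10, 32, 37], [11, 15, 16], [12, 25, 29], [13, 26, 27], [14, 19, 33], [28,
    31, 36]], [[1, 25, 31], [2, 33, 34], [3, 6, 7], [4, 27, 39], [5, 16, 26], [8, 11, 17], [9, 15,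
    38], [10, 21, 24], [12, 20, 35], [13, 22, 23], [14, 28, 32], [18, 19, 37], [29, 30, 36]], [[1,
    10, 17], [2, 28, 35], [3, 19, 22], [4, 9, 36], [5, 6, 14], [7, 33, 39], [8, 23, 32], [11, 12,
    38], [13, 31, 34], [15, 30, 37], [16, 20, 21], [18, 26, 29], [24, 25, 27]], [[1, 11, 23], [2,
    24, 37], [3, 30, 31], [4, 17, 18], [5, 29, 39], [6, 34, 36], [7, 9, 10], [8, 21, 35], [12, 27,
    33], [13, 19, 32], [14, 16, 38], [15, 20, 25], [22, 26, 28]], [[1, 12, 36], [2, 16, 25], [3, 5,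
    28], [4, 10, 30], [6, 15, 26], [7, 8, 24], [9, 13, 20], [11, 18, 35], [14, 17, 23], [19, 38,
    39], [21, 22, 33], [27, 31, 37], [29, 32, 34]], [[1, 24, 26], [2, 15, 31], [3, 35, 39], [4, 7,
    14], [5, 21, 36], [6, 32, 33], [8, 13, 18], [9, 22, 27], [10, 16, 34], [11, 19, 30], [12, 23,
    28], [17, 25, 37], [20, 29, 38]], [[1, 27, 30], [2, 7, 22], [3, 8, 29], [4, 20, 28], [5, 33,
    37], [6, 19, 25], [9, 16, 18], [10, 35, 36], [11, 24, 34], [12, 26, 39], [13, 14, 15], [17, 31,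
    32], [21, 23, 38]], [[1, 3, 33], [2, 10, 13], [4, 5, 8], [6, 23, 30], [7, 32, 36], [9, 19, 28],
    [11, 26, 31], [12, 14, 34], [15, 24, 35], [16, 29, 37], [17, 21, 27], [18, 20, 39], [22, 25,
    38]], [[1, 13, 16], [2, 8, 14], [3, 20, 26], [4, 12, 37], [5, 25, 35], [6, 28, 29], [7, 21,
    34], [9, 30, 33], [10, 18, 22], [11, 27, 32], [15, 23, 39], [17, 19, 36], [24, 31, 38]], [[1,
    19, 20], [2, 36, 39], [3, 9, 11], [4, 22, 34], [5, 23, 31], [6, 21, 37], [7, 30, 35], [8, 25,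
    28], [10, 14, 27], [12, 15, 18], [13, 17, 29], [16, 24, 33], [26, 32, 38]], [[1, 34, 37], [2,
    26, 30], [3, 14, 18], [4, 25, 32], [5, 19, 24], [6, 20, 22], [7, 15, 17], [8, 9, 31], [10, 28,
    39], [11, 29, 33], [12, 13, 21], [16, 23, 36], [27, 35, 38]], [[1, 29, 35], [2, 18, 32], [3,
    10, 15], [4, 19, 23], [5, 27, 34], [6, 12, 17], [7, 20, 37], [8, 30, 39], [9, 25, 26], [11, 14,
    21], [13, 24, 36], [16, 22, 31], [28, 33, 38]], [[1, 2, 6], [3, 13, 37], [4, 31, 33], [5, 15,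
    32], [7, 19, 26], [8, 10, 12], [9, 21, 29], [11, 20, 36], [14, 24, 39], [16, 27, 28], [17, 22,
    35], [18, 23, 25], [30, 34, 38]], [[1, 22, 32], [2, 3, 12], [4, 21, 26], [5, 10, 11], [6, 18,
    27], [7, 29, 31], [8, 15, 33], [9, 23, 34], [13, 25, 39], [14, 20, 30], [16, 19, 35], [17, 24,
    28], [36, 37, 38]]]),
    (38,
    [[[0, 19, 39], [1, 7, 11], [2, 32, 36], [3, 29, 35], [4, 6, 9], [5, 16, 17], [8, 30, 33], [10,
    27, 28], [12, 21, 26], [13, 25, 37], [14, 24, 34], [15, 23, 31], [18, 20, 22]], [[0, 21, 23],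
    [1, 20, 39], [2, 8, 12], [3, 33, 37], [4, 30, 36], [5, 7, 10], [6, 17, 18], [9, 31, 34], [11,
    28, 29], [13, 22, 27], [14, 19, 26], [15, 25, 35], [16, 24, 32]], [[0, 7, 18], [1, 22, 24], [2,
    21, 39], [3, 9, 13], [4, 19, 34], [5, 31, 37], [6, 8, 11], [10, 32, 35], [12, 29, 30], [14, 23,
    28], [15, 20, 27], [16, 26, 36], [17, 25, 33]], [[0, 1, 8], [2, 23, 25], [3, 22, 39], [4, 10,
    14], [5, 20, 35], [6, 19, 32], [7, 9, 12], [11, 33, 36], [13, 30, 31], [15, 24, 29], [16, 21,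
    28], [17, 27, 37], [18, 26, 34]], [[0, 27, 35], [1, 2, 9], [3, 24, 26], [4, 23, 39], [5, 11,
    15], [6, 21, 36], [7, 20, 33], [8, 10, 13], [12, 34, 37], [14, 31, 32], [16, 25, 30], [17, 22,
    29], [18, 19, 28]], [[0, 20, 29], [1, 28, 36], [2, 3, 10], [4, 25, 27], [5, 24, 39], [6, 12,
    16], [7, 22, 37], [8, 21, 34], [9, 11, 14], [13, 19, 35], [15, 32, 33], [17, 26, 31], [18, 23,
    30]], [[0, 24, 31], [1, 21, 30], [2, 29, 37], [3, 4, 11], [5, 26, 28], [6, 25, 39], [7, 13,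
    17], [8, 19, 23], [9, 22, 35], [10, 12, 15], [14, 20, 36], [16, 33, 34], [18, 27, 32]], [[0,
    28, 33], [1, 25, 32], [2, 22, 31], [3, 19, 30], [4, 5, 12], [6, 27, 29], [7, 26, 39], [8, 14,
    18], [9, 20, 24], [10, 23, 36], [11, 13, 16], [15, 21, 37], [17, 34, 35]], [[0, 9, 15], [1, 29,
    34], [2, 26, 33], [3, 23, 32], [4, 20, 31], [5, 6, 13], [7, 28, 30], [8, 27, 39], [10, 21, 25],
    [11, 24, 37], [12, 14, 17], [16, 19, 22], [18, 35, 36]], [[0, 36, 37], [1, 10, 16], [2, 30,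
    35], [3, 27, 34], [4, 24, 33], [5, 21, 32], [6, 7, 14], [8, 29, 31], [9, 28, 39], [11, 22, 26],
    [12, 19, 25], [13, 15, 18], [17, 20, 23]], [[0, 14, 16], [1, 19, 37], [2, 11, 17], [3, 31, 36],
    [4, 28, 35], [5, 25, 34], [6, 22, 33], [7, 8, 15], [9, 30, 32], [10, 29, 39], [12, 23, 27],
    [13, 20, 26], [18, 21, 24]], [[0, 22, 25], [1, 15, 17], [2, 19, 20], [3, 12, 18], [4, 32, 37],
    [5, 29, 36], [6, 26, 35], [7, 23, 34], [8, 9, 16], [10, 31, 33], [11, 30, 39], [13, 24, 28],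
    [14, 21, 27]], [[0, 4, 13], [1, 23, 26], [2, 16, 18], [3, 20, 21], [5, 19, 33], [6, 30, 37],
    [7, 27, 36], [8, 24, 35], [9, 10, 17], [11, 32, 34], [12, 31, 39], [14, 25, 29], [15, 22, 28]],
    [[0, 3, 17], [1, 5, 14], [2, 24, 27], [4, 21, 22], [6, 20, 34], [7, 19, 31], [8, 28, 37], [9,
    25, 36], [10, 11, 18], [12, 33, 35], [13, 32, 39], [15, 26, 30], [16, 23, 29]], [[0, 11, 12],
    [1, 4, 18], [2, 6, 15], [3, 25, 28], [5, 22, 23], [7, 21, 35], [8, 20, 32], [9, 19, 29], [10,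
    26, 37], [13, 34, 36], [14, 33, 39], [16, 27, 31], [17, 24, 30]], [[0, 2, 5], [1, 12, 13], [3,
    7, 16], [4, 26, 29], [6, 23, 24], [8, 22, 36], [9, 21, 33], [10, 20, 30], [11, 19, 27], [14,
    35, 37], [15, 34, 39], [17, 28, 32], [18, 25, 31]], [[0, 26, 32], [1, 3, 6], [2, 13, 14], [4,
    8, 17], [5, 27, 30], [7, 24, 25], [9, 23, 37], [10, 22, 34], [11, 21, 31], [12, 20, 28], [15,
    19, 36], [16, 35, 39], [18, 29, 33]], [[0, 30, 34], [1, 27, 33], [2, 4, 7], [3, 14, 15], [5, 9,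
    18], [6, 28, 31], [8, 25, 26], [10, 19, 24], [11, 23, 35], [12, 22, 32], [13, 21, 29], [16, 20,
    37], [17, 36, 39]], [[0, 6, 10], [1, 31, 35], [2, 28, 34], [3, 5, 8], [4, 15, 16], [7, 29, 32],
    [9, 26, 27], [11, 20, 25], [12, 24, 36], [13, 23, 33], [14, 22, 30], [17, 19, 21], [18, 37,
    39]]])]

theorem check_quadrupleSystem40 : quadrupleSystem40.check = true := by decide +kernel

end OrbitPresentation

/-- `C` is a `3`-design on the points of `P` with blocks of size `q + 1` (called circles), such that
the circles through any point `x` fall into parallel classes, each of which partitions the other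
points; `dir` is the parallel class of a circle at `x`. -/
structure IsCircleGeometry {P : Type*} (q : ℕ) (C : Set (Set P)) : Prop where
  ncard_circle : ∀ c ∈ C, c.ncard = q + 1
  cover : ∀ x y z, x ≠ y → x ≠ z → y ≠ z → ∃! c, c ∈ C ∧ x ∈ c ∧ y ∈ c ∧ z ∈ c
  parallel : ∀ x, ∃ dir : Set P → Set P, ∀ c ∈ C, x ∈ c → ∀ y, x ≠ y →
    ∃! c', c' ∈ C ∧ x ∈ c' ∧ y ∈ c' ∧ dir c' = dir c

section MoebiusGeometry

open OnePoint Pointwise Matrix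

variable {K : Type*} [Field K] [DecidableEq K]

set_option linter.unusedSectionVars false

theorem OnePoint.exists_smul_infty_eq (x : OnePoint K) :
    ∃ g : GL (Fin 2) K, g • (∞ : OnePoint K) = x := by
  cases x with
  | infty => exact ⟨1, one_smul _ _⟩
  | coe a =>
    refine ⟨GeneralLinearGroup.mkOfDetNeZero !![a, -1; 1, 0] (by simp [det_fin_two]), ?_⟩
    rw [smul_infty_eq_ite]
    simp [GeneralLinearGroup.mkOfDetNeZero]

/-- The affine map `s ↦ t * s + a` as an element of `GL(2, K)`. -/
def affineGL (a t : K) (ht : t ≠ 0) : GL (Fin 2) K :=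
  GeneralLinearGroup.mkOfDetNeZero !![t, a; 0, 1] (by simpa [det_fin_two])

theorem affineGL_smul_infty (a t : K) (ht : t ≠ 0) : affineGL a t ht • (∞ : OnePoint K) = ∞ := by
  rw [smul_infty_eq_ite]
  simp [affineGL, GeneralLinearGroup.mkOfDetNeZero]

theorem affineGL_smul_coe (a t : K) (ht : t ≠ 0) (s : K) :
    affineGL a t ht • (s : OnePoint K) = ((t * s + a : K) : OnePoint K) := by
  rw [smul_some_eq_ite]
  simp [affineGL, GeneralLinearGroup.mkOfDetNeZero]

theorem OnePoint.exists_smul_eq {x y z : OnePoint K} (hxy : x ≠ y) (hxz : x ≠ z) (hyz : y ≠ z) :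
    ∃ g : GL (Fin 2) K, g • (∞ : OnePoint K) = x ∧ g • ((0 : K) : OnePoint K) = y ∧
      g • ((1 : K) : OnePoint K) = z := by
  obtain ⟨g, rfl⟩ := exists_smul_infty_eq x
  obtain ⟨y, rfl⟩ := MulAction.surjective g y
  obtain ⟨z, rfl⟩ := MulAction.surjective g z
  rw [Ne, smul_left_cancel_iff] at hxy hxz hyz
  obtain ⟨a, rfl⟩ := ne_infty_iff_exists.1 (Ne.symm hxy)
  obtain ⟨b, rfl⟩ := ne_infty_iff_exists.1 (Ne.symm hxz)
  have hab : b - a ≠ 0 := fun h => hyz (by rw [sub_eq_zero.1 h])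
  refine ⟨g * affineGL a (b - a) hab, ?_, ?_, ?_⟩
  · rw [mul_smul, affineGL_smul_infty]
  · rw [mul_smul, affineGL_smul_coe]; simp
  · rw [mul_smul, affineGL_smul_coe]; simp

theorem OnePoint.smul_eq_self_of_fixes {g : GL (Fin 2) K} (h : g • (∞ : OnePoint K) = ∞)
    (h0 : g • ((0 : K) : OnePoint K) = (0 : K)) (h1 : g • ((1 : K) : OnePoint K) = (1 : K))
    (x : OnePoint K) : g • x = x := by
  have hc := smul_infty_eq_self_iff.1 h
  have hd : g 1 1 ≠ 0 := by
    intro hd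
    have := g.det_ne_zero
    simp [det_fin_two, hc, hd] at this
  rw [smul_some_eq_ite] at h0 h1
  simp only [hc, hd, mul_zero, zero_add, if_false, OnePoint.coe_eq_coe, div_eq_zero_iff,
    or_false, mul_one, div_eq_one_iff_eq, Ne, not_false_eq_true] at h0 h1
  cases x with
  | infty => exact h
  | coe s =>
    rw [smul_some_eq_ite]
    rw [h0, add_zero] at h1
    simp [hc, hd, h0, h1]

variable (F : Type*) [Field F] [DecidableEq F] [Algebra F K]

variable (K) in
/-- The projective line over the subfield `F`. -/
def subline : Set (OnePoint K) := Set.range (OnePoint.map (algebraMap F K))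

variable (K) in
/-- The images of the projective line over `F` under Möbius transformations. -/
def circles : Set (Set (OnePoint K)) := Set.range fun g : GL (Fin 2) K => g • subline K F

theorem infty_mem_subline : (∞ : OnePoint K) ∈ subline K F := ⟨∞, rfl⟩

theorem coe_mem_subline {s : K} : (s : OnePoint K) ∈ subline K F ↔ ∃ r : F, algebraMap F K r = s := by
  constructor
  · rintro ⟨x, hx⟩
    cases x with
    | infty => exact (infty_ne_coe _ hx).elim
    | coe r => exact ⟨r, by simpa using hx⟩
  · rintro ⟨r, rfl⟩
    exact ⟨r, rfl⟩

theorem coe_zero_mem_subline : ((0 : K) : OnePoint K) ∈ subline K F :=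
  (coe_mem_subline F).2 ⟨0, map_zero _⟩

theorem coe_one_mem_subline : ((1 : K) : OnePoint K) ∈ subline K F :=
  (coe_mem_subline F).2 ⟨1, map_one _⟩

theorem map_smul_subline (h : GL (Fin 2) F) :
    h.map (algebraMap F K) • subline K F = subline K F := by
  have key : ∀ h : GL (Fin 2) F, h.map (algebraMap F K) • subline K F ⊆ subline K F := by
    rintro h _ ⟨_, ⟨x, rfl⟩, rfl⟩
    exact ⟨h • x, OnePoint.map_smul _ _ _⟩
  refine (key h).antisymm ?_
  rw [Set.subset_smul_set_iff, ← map_inv]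
  exact key _

theorem smul_subline_eq {g : GL (Fin 2) K} (h : (∞ : OnePoint K) ∈ g • subline K F)
    (h0 : ((0 : K) : OnePoint K) ∈ g • subline K F) (h1 : ((1 : K) : OnePoint K) ∈ g • subline K F) :
    g • subline K F = subline K F := by
  obtain ⟨_, ⟨x, rfl⟩, hx⟩ := h
  obtain ⟨_, ⟨y, rfl⟩, hy⟩ := h0
  obtain ⟨_, ⟨z, rfl⟩, hz⟩ := h1
  simp only at hx hy hz
  obtain ⟨e, rfl, rfl, rfl⟩ := OnePoint.exists_smul_eq (x := x) (y := y) (z := z)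
    (by rintro rfl; exact infty_ne_coe _ (hx.symm.trans hy))
    (by rintro rfl; exact infty_ne_coe _ (hx.symm.trans hz))
    (by rintro rfl; simpa using hy.symm.trans hz)
  rw [OnePoint.map_smul, ← mul_smul] at hx hy hz
  have hfix := OnePoint.smul_eq_self_of_fixes (g := g * e.map (algebraMap F K)) hx
    (by simpa using hy) (by simpa using hz)
  rw [← map_smul_subline F e, ← mul_smul]
  conv_rhs => rw [map_smul_subline]
  ext x
  rw [Set.mem_smul_set_iff_inv_smul_mem, inv_smul_eq_iff.2 (hfix x).symm]

theorem existsUnique_circle {x y z : OnePoint K} (hxy : x ≠ y) (hxz : x ≠ z) (hyz : y ≠ z) :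
    ∃! c, c ∈ circles K F ∧ x ∈ c ∧ y ∈ c ∧ z ∈ c := by
  obtain ⟨g, rfl, rfl, rfl⟩ := OnePoint.exists_smul_eq hxy hxz hyz
  refine ⟨g • subline K F, ⟨⟨g, rfl⟩, Set.smul_mem_smul_set (infty_mem_subline F),
    Set.smul_mem_smul_set (coe_zero_mem_subline F),
    Set.smul_mem_smul_set (coe_one_mem_subline F)⟩, ?_⟩
  rintro _ ⟨⟨e, rfl⟩, h, h0, h1⟩
  simp only at h h0 h1 ⊢
  rw [← Set.mem_inv_smul_set_iff, ← mul_smul] at h h0 h1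
  have := smul_subline_eq F h h0 h1
  rw [mul_smul, inv_smul_eq_iff] at this
  exact this

theorem smul_mem_circles {c : Set (OnePoint K)} (g : GL (Fin 2) K) (hc : c ∈ circles K F) :
    g • c ∈ circles K F := by
  obtain ⟨e, rfl⟩ := hc
  exact ⟨g * e, mul_smul _ _ _⟩

theorem coe_mem_affineGL_smul {a t s : K} (ht : t ≠ 0) :
    (s : OnePoint K) ∈ affineGL a t ht • subline K F ↔ ∃ r : F, s = t * algebraMap F K r + a := by
  constructor
  · rintro ⟨x, hx, hs⟩
    simp only at hs
    cases x with
    | infty => exact (infty_ne_coe _ ((affineGL_smul_infty a t ht).symm.trans hs)).elim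
    | coe u =>
      obtain ⟨r, rfl⟩ := (coe_mem_subline F).1 hx
      rw [affineGL_smul_coe, OnePoint.coe_eq_coe] at hs
      exact ⟨r, hs.symm⟩
  · rintro ⟨r, rfl⟩
    rw [← affineGL_smul_coe a t ht]
    exact Set.smul_mem_smul_set ((coe_mem_subline F).2 ⟨r, rfl⟩)

theorem infty_mem_affineGL_smul {a t : K} (ht : t ≠ 0) :
    (∞ : OnePoint K) ∈ affineGL a t ht • subline K F := by
  conv => rw [← affineGL_smul_infty a t ht]
  exact Set.smul_mem_smul_set (infty_mem_subline F)

/-- The circles through `∞` are the affine lines, completed by `∞`. -/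
theorem exists_eq_affineGL_smul {c : Set (OnePoint K)} (hc : c ∈ circles K F) (h : ∞ ∈ c) :
    ∃ (a t : K) (ht : t ≠ 0), c = affineGL a t ht • subline K F := by
  have h2 : ∃ a b : K, a ≠ b ∧ (a : OnePoint K) ∈ c ∧ (b : OnePoint K) ∈ c := by
    obtain ⟨g, rfl⟩ := hc
    have key : ∀ x y : OnePoint K, x ∈ g • subline K F → y ∈ g • subline K F →
        x ≠ y → x ≠ ∞ → y ≠ ∞ → ∃ a b : K, a ≠ b ∧ (a : OnePoint K) ∈ g • subline K F ∧
          (b : OnePoint K) ∈ g • subline K F := by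
      intro x y hx hy hxy hx' hy'
      obtain ⟨a, rfl⟩ := ne_infty_iff_exists.1 hx'
      obtain ⟨b, rfl⟩ := ne_infty_iff_exists.1 hy'
      exact ⟨a, b, fun e => hxy (by rw [e]), hx, hy⟩
    have m := Set.smul_mem_smul_set (a := g) (infty_mem_subline (K := K) F)
    have m0 := Set.smul_mem_smul_set (a := g) (coe_zero_mem_subline (K := K) F)
    have m1 := Set.smul_mem_smul_set (a := g) (coe_one_mem_subline (K := K) F)
    have e0 : g • (∞ : OnePoint K) ≠ g • ((0 : K) : OnePoint K) := by
      rw [Ne, smul_left_cancel_iff]; exact infty_ne_coe _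
    have e1 : g • (∞ : OnePoint K) ≠ g • ((1 : K) : OnePoint K) := by
      rw [Ne, smul_left_cancel_iff]; exact infty_ne_coe _
    have e2 : g • ((0 : K) : OnePoint K) ≠ g • ((1 : K) : OnePoint K) := by
      rw [Ne, smul_left_cancel_iff]; simp
    by_cases i : g • (∞ : OnePoint K) = ∞
    · exact key _ _ m0 m1 e2 (fun h => e0 (i.trans h.symm)) (fun h => e1 (i.trans h.symm))
    by_cases i0 : g • ((0 : K) : OnePoint K) = ∞
    · exact key _ _ m m1 e1 i (fun h => e2 (i0.trans h.symm))
    · exact key _ _ m m0 e0 i i0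
  obtain ⟨a, b, hab, ha, hb⟩ := h2
  have ht : b - a ≠ 0 := fun e => hab (sub_eq_zero.1 e).symm
  refine ⟨a, b - a, ht, (existsUnique_circle F (infty_ne_coe a) (infty_ne_coe b)
    (fun e => hab (OnePoint.coe_eq_coe.1 e))).unique ⟨hc, h, ha, hb⟩
    ⟨⟨_, rfl⟩, infty_mem_affineGL_smul F ht, (coe_mem_affineGL_smul F ht).2 ⟨0, by simp⟩,
      (coe_mem_affineGL_smul F ht).2 ⟨1, by simp⟩⟩⟩

/-- The set of differences of finite points of a set. -/
def differences (c : Set (OnePoint K)) : Set (OnePoint K) :=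
  {p | ∃ a b : K, (a : OnePoint K) ∈ c ∧ (b : OnePoint K) ∈ c ∧ p = ((b - a : K) : OnePoint K)}

theorem coe_mem_differences {a t u : K} (ht : t ≠ 0) :
    (u : OnePoint K) ∈ differences (affineGL a t ht • subline K F) ↔
      ∃ r : F, u = t * algebraMap F K r := by
  simp only [differences, coe_mem_affineGL_smul, Set.mem_ofPred_eq, OnePoint.coe_eq_coe]
  constructor
  · rintro ⟨_, _, ⟨r, rfl⟩, ⟨s, rfl⟩, rfl⟩
    exact ⟨s - r, by rw [map_sub]; ring⟩
  · rintro ⟨r, rfl⟩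
    exact ⟨_, _, ⟨0, rfl⟩, ⟨r, rfl⟩, by rw [map_zero]; ring⟩

theorem coe_mem_iff_sub_mem_differences {c : Set (OnePoint K)} (hc : c ∈ circles K F)
    (h : ∞ ∈ c) {b s : K} (hb : (b : OnePoint K) ∈ c) :
    (s : OnePoint K) ∈ c ↔ ((s - b : K) : OnePoint K) ∈ differences c := by
  obtain ⟨a, t, ht, rfl⟩ := exists_eq_affineGL_smul F hc h
  obtain ⟨r, rfl⟩ := (coe_mem_affineGL_smul F ht).1 hb
  rw [coe_mem_differences, coe_mem_affineGL_smul]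
  constructor
  · rintro ⟨s, rfl⟩
    exact ⟨s - r, by rw [map_sub]; ring⟩
  · rintro ⟨s, h⟩
    exact ⟨s + r, by rw [map_add]; linear_combination h⟩

theorem existsUnique_parallel {c : Set (OnePoint K)} (hc : c ∈ circles K F) (h : ∞ ∈ c)
    {y : OnePoint K} (hy : ∞ ≠ y) :
    ∃! c', c' ∈ circles K F ∧ ∞ ∈ c' ∧ y ∈ c' ∧ differences c' = differences c := by
  obtain ⟨b, rfl⟩ := ne_infty_iff_exists.1 hy.symm
  obtain ⟨a, t, ht, rfl⟩ := exists_eq_affineGL_smul F hc h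
  refine ⟨affineGL b t ht • subline K F, ⟨⟨_, rfl⟩, infty_mem_affineGL_smul F ht,
    (coe_mem_affineGL_smul F ht).2 ⟨0, by simp⟩, ?_⟩, ?_⟩
  · ext p
    cases p with
    | infty => simp [differences]
    | coe u => rw [coe_mem_differences, coe_mem_differences]
  · rintro c' ⟨hc', h', hb, hd⟩
    ext p
    cases p with
    | infty => simp [h', infty_mem_affineGL_smul]
    | coe s =>
      rw [coe_mem_iff_sub_mem_differences F hc' h' hb, hd, coe_mem_differences,
        coe_mem_affineGL_smul]
      simp only [sub_eq_iff_eq_add]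

theorem isCircleGeometry_circles [Finite F] : IsCircleGeometry (Nat.card F) (circles K F) where
  ncard_circle := by
    rintro _ ⟨g, rfl⟩
    have : (g • subline K F).ncard = (subline K F).ncard :=
      Set.ncard_image_of_injective _ (MulAction.injective g)
    simp only [this]
    rw [subline, ← Set.image_univ, Set.ncard_image_of_injective, Set.ncard_univ]
    · exact Finite.card_option
    · exact Option.map_injective (algebraMap F K).injective
  cover := fun x y z => existsUnique_circle F
  parallel := by
    intro x
    obtain ⟨g, rfl⟩ := OnePoint.exists_smul_infty_eq x
    refine ⟨fun c => differences (g⁻¹ • c), fun c hc hx y hy => ?_⟩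
    rw [← Set.mem_inv_smul_set_iff] at hx
    obtain ⟨c', ⟨h1, h2, h3, h4⟩, hu⟩ := existsUnique_parallel F (smul_mem_circles F g⁻¹ hc) hx
      (y := g⁻¹ • y) (fun e => hy (by rw [e, smul_inv_smul]))
    refine ⟨g • c', ⟨smul_mem_circles F g h1, Set.smul_mem_smul_set h2,
      Set.mem_smul_set_iff_inv_smul_mem.2 h3, by simpa only [inv_smul_smul] using h4⟩, ?_⟩
    rintro c'' ⟨k1, k2, k3, k4⟩
    rw [← hu (g⁻¹ • c'') ⟨smul_mem_circles F g⁻¹ k1, Set.mem_inv_smul_set_iff.2 k2,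
      Set.smul_mem_smul_set k3, k4⟩, smul_inv_smul]

end MoebiusGeometry

/-- A quadruple system with colourings of the blocks through each point whose colour classes are
parallel classes is an `RDSQS`. -/
theorem isRDSQS_of_colouring {α κ : Type*} [Fintype α] [DecidableEq α] {B : Finset (Finset α)}
    (h4 : ∀ b ∈ B, #b = 4)
    (hcover : ∀ x y z, x ≠ y → x ≠ z → y ≠ z → ∃! b, b ∈ B ∧ x ∈ b ∧ y ∈ b ∧ z ∈ b)
    (hres : ∀ x, ∃ col : Finset α → κ, ∀ b ∈ B, x ∈ b → ∀ y, x ≠ y →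
      ∃! b', b' ∈ B ∧ x ∈ b' ∧ y ∈ b' ∧ col b' = col b) :
    IsRDSQS (Fintype.card α) univ B := by
  refine ⟨⟨card_univ, fun _ _ => subset_univ _, h4, fun T _ hT => ?_⟩, fun x _ => ?_⟩
  · obtain ⟨x, y, z, hxy, hxz, hyz, rfl⟩ := card_eq_three.1 hT
    simpa [insert_subset_iff] using hcover x y z hxy hxz hyz
  · classical
    obtain ⟨col, hcol⟩ := hres x
    let D := derivedBlocks B x
    have hD : ∀ t, t ∈ D ↔ x ∉ t ∧ insert x t ∈ B := by
      intro t
      simp only [D, derivedBlocks, mem_image, mem_filter]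
      constructor
      · rintro ⟨b, ⟨hb, hx⟩, rfl⟩
        exact ⟨notMem_erase _ _, by rwa [insert_erase hx]⟩
      · rintro ⟨hx, hb⟩
        exact ⟨_, ⟨hb, mem_insert_self _ _⟩, erase_insert hx⟩
    let s : Setoid (Finset α) := Setoid.ker fun t => col (insert x t)
    refine ⟨Finpartition.ofSetSetoid s D, ?_⟩
    rw [Finpartition.ofSetSetoid_parts]
    simp only [mem_image, forall_exists_index, and_imp]
    rintro _ t ht rfl
    obtain ⟨hxt, htB⟩ := (hD t).1 ht
    suffices h : ∀ P : Finset (Finset α),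
        (∀ p, p ∈ P ↔ p ∈ D ∧ col (insert x t) = col (insert x p)) →
        IsParallelClass (univ.erase x) P from h _ fun p => mem_filter
    intro P hP
    refine ⟨Finpartition.ofExistsUnique P ?_ ?_ ?_, rfl⟩
    · intro p hp y hy
      rw [hP, hD] at hp
      exact mem_erase.2 ⟨fun e => hp.1.1 (e ▸ hy), mem_univ y⟩
    · intro y hy
      have hxy : x ≠ y := (mem_erase.1 hy).1.symm
      obtain ⟨b, ⟨hb, hxb, hyb, hc⟩, hu⟩ := hcol _ htB (mem_insert_self _ _) y hxy
      refine ⟨b.erase x, ⟨(hP _).2 ⟨(hD _).2 ⟨notMem_erase _ _, by rwa [insert_erase hxb]⟩, ?_⟩,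
        mem_erase.2 ⟨hxy.symm, hyb⟩⟩, ?_⟩
      · rw [insert_erase hxb, hc]
      · rintro p ⟨hp, hyp⟩
        rw [hP, hD] at hp
        rw [← hu (insert x p) ⟨hp.1.2, mem_insert_self _ _, mem_insert_of_mem hyp, hp.2.symm⟩,
          erase_insert hp.1.1]
    · intro h
      rw [hP, hD] at h
      have := h4 _ h.1.2
      simp at this

section Filling

variable {K : Type*} [DecidableEq K]

set_option linter.unusedSectionVars false

/-- The projection of the points of the large system to the points of the circle geometry. -/
def proj (w : Option (K × Fin 3)) : Option K := w.map Prod.fst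

/-- The quadruple consisting of the point at infinity and the three points above `u`. -/
def fill (u : K) : Finset (Option (K × Fin 3)) :=
  insert none (univ.image fun j : Fin 3 => some (u, j))

theorem proj_eq_none {w : Option (K × Fin 3)} : proj w = none ↔ w = none := by simp [proj]

theorem mem_fill {u : K} {w : Option (K × Fin 3)} :
    w ∈ fill u ↔ proj w = none ∨ proj w = some u := by
  rcases w with _ | ⟨v, j⟩
  · simp [fill, proj]
  · simp [fill, proj, eq_comm]

theorem card_fill (u : K) : #(fill u) = 4 := by
  rw [fill, card_insert_of_notMem (by simp),
    card_image_of_injective _ (fun i j h => by simpa using h)]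
  rfl

/-- The blocks `A` placed above a circle `c`: if `c` contains the point at infinity, they form a
quadruple system that contains the quadruples `fill u`, all coloured `none`; otherwise they form an
`H`-design, and the colour `none` is not used. -/
structure IsCircleFilling (m : ℕ) (c : Set (Option K)) (A : Finset (Finset (Option (K × Fin 3)))) :
    Prop where
  card_block : ∀ b ∈ A, #b = 4
  proj_mem : ∀ b ∈ A, ∀ w ∈ b, proj w ∈ c
  injOn : none ∉ c → ∀ b ∈ A, Set.InjOn proj (b : Set (Option (K × Fin 3)))
  fill_mem : none ∈ c → ∀ u, some u ∈ c → fill u ∈ A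
  cover : ∀ x y z, proj x ∈ c → proj y ∈ c → proj z ∈ c → x ≠ y → x ≠ z → y ≠ z →
    (none ∉ c → proj x ≠ proj y ∧ proj x ≠ proj z ∧ proj y ≠ proj z) →
    ∃! b, b ∈ A ∧ x ∈ b ∧ y ∈ b ∧ z ∈ b
  resolution : ∀ x, proj x ∈ c → ∃ col : Finset (Option (K × Fin 3)) → Option (Fin m),
    (∀ y, proj y ∈ c → x ≠ y → (none ∉ c → proj x ≠ proj y) → ∀ k : Fin m,
      ∃! b, b ∈ A ∧ x ∈ b ∧ y ∈ b ∧ col b = some k) ∧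
    (none ∈ c → ∀ y, proj y ∈ c → x ≠ y → ∃! b, b ∈ A ∧ x ∈ b ∧ y ∈ b ∧ col b = none) ∧
    (none ∉ c → ∀ b, col b ≠ none) ∧
    (none ∈ c → ∀ u, some u ∈ c → x ∈ fill u → col (fill u) = none)

variable {q m : ℕ} {C : Set (Set (Option K))}
  {A : Set (Option K) → Finset (Finset (Option (K × Fin 3)))}

/-- The point of the circle geometry that, together with `proj x`, spans the pair `x`, `y`. -/
def span (x y : Option (K × Fin 3)) : Option K := if proj x = proj y then none else proj y

theorem proj_ne_span {x y : Option (K × Fin 3)} (h : x ≠ y) : proj x ≠ span x y := by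
  unfold span
  split_ifs with e
  · intro h0
    exact h ((proj_eq_none.1 h0).trans (proj_eq_none.1 (e ▸ h0)).symm)
  · exact e

theorem IsCircleFilling.span_mem {c : Set (Option K)} {D : Finset (Finset (Option (K × Fin 3)))}
    (h : IsCircleFilling m c D) {b : Finset (Option (K × Fin 3))} (hb : b ∈ D)
    {x y : Option (K × Fin 3)} (hx : x ∈ b) (hy : y ∈ b) (hxy : x ≠ y) : span x y ∈ c := by
  unfold span
  split_ifs with e
  · by_contra hn
    exact hxy (h.injOn hn b hb hx hy e)
  · exact h.proj_mem b hb y hy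

theorem proj_mem_of_span_mem {c : Set (Option K)} {x y : Option (K × Fin 3)} (hx : proj x ∈ c)
    (h : span x y ∈ c) : proj y ∈ c ∧ (none ∉ c → proj x ≠ proj y) := by
  unfold span at h
  split_ifs at h with e
  · exact ⟨e ▸ hx, fun hn => (hn h).elim⟩
  · exact ⟨h, fun _ => e⟩

theorem circle_eq_of_common_block (hC : IsCircleGeometry q C)
    (hA : ∀ c ∈ C, IsCircleFilling m c (A c)) {c c' : Set (Option K)} (hc : c ∈ C) (hc' : c' ∈ C)
    {b : Finset (Option (K × Fin 3))} (hb : b ∈ A c) (hb' : b ∈ A c') (hf : ∀ u, b ≠ fill u) :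
    c = c' := by
  have key : ∀ c ∈ C, ∀ c' ∈ C, b ∈ A c → b ∈ A c' → none ∉ c → c = c' := by
    intro c hc c' hc' hb hb' hn
    obtain ⟨x, hx, y, hy, z, hz, hxy, hxz, hyz⟩ := two_lt_card.1
      (show 2 < #b by rw [(hA c hc).card_block b hb]; norm_num)
    have hi := (hA c hc).injOn hn b hb
    have p := (hA c hc).proj_mem b hb
    have p' := (hA c' hc').proj_mem b hb'
    exact (hC.cover _ _ _ (hi.ne hx hy hxy) (hi.ne hx hz hxz) (hi.ne hy hz hyz)).unique
      ⟨hc, p x hx, p y hy, p z hz⟩ ⟨hc', p' x hx, p' y hy, p' z hz⟩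
  by_cases hn : none ∉ c
  · exact key c hc c' hc' hb hb' hn
  by_cases hn' : none ∉ c'
  · exact (key c' hc' c hc hb' hb hn').symm
  rw [not_not] at hn hn'
  have p := (hA c hc).proj_mem b hb
  have p' := (hA c' hc').proj_mem b hb'
  obtain ⟨z, hz, hz0⟩ := exists_mem_ne
    (show 1 < #b by rw [(hA c hc).card_block b hb]; norm_num) none
  obtain ⟨u, hu⟩ := Option.ne_none_iff_exists'.1 (fun h => hz0 (proj_eq_none.1 h))
  by_contra hcc
  refine hf u (eq_of_subset_of_card_le (fun w hw => ?_) ?_)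
  · rw [mem_fill]
    by_contra! h
    exact hcc ((hC.cover none (some u) (proj w) (by simp) h.1.symm h.2.symm).unique
      ⟨hc, hn, hu ▸ p z hz, p w hw⟩ ⟨hc', hn', hu ▸ p' z hz, p' w hw⟩)
  · rw [card_fill, (hA c hc).card_block b hb]

theorem IsCircleGeometry.exists_circle [Nontrivial K] (hC : IsCircleGeometry q C) (u : K) :
    ∃ c ∈ C, none ∈ c ∧ some u ∈ c := by
  obtain ⟨v, hv⟩ := exists_ne u
  obtain ⟨c, ⟨hc, h0, h1, _⟩, _⟩ := hC.cover none (some u) (some v) (by simp) (by simp)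
    (by simpa using hv.symm)
  exact ⟨c, hc, h0, h1⟩

section

variable [Fintype K] [Nontrivial K] (hC : IsCircleGeometry q C)
  (hA : ∀ c ∈ C, IsCircleFilling m c (A c)) {B : Finset (Finset (Option (K × Fin 3)))}
  (hB : ∀ b, b ∈ B ↔ ∃ c ∈ C, b ∈ A c)

include hC hA hB

theorem filling_cover_of_span {x y z : Option (K × Fin 3)} (hxy : x ≠ y) (hxz : x ≠ z)
    (hyz : y ≠ z) {p₁ p₂ p₃ : Option K} (h12 : p₁ ≠ p₂) (h13 : p₁ ≠ p₃) (h23 : p₂ ≠ p₃)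
    (h : ∀ c ∈ C, ∀ b ∈ A c, x ∈ b → y ∈ b → z ∈ b → p₁ ∈ c ∧ p₂ ∈ c ∧ p₃ ∈ c)
    (h' : ∀ c ∈ C, p₁ ∈ c → p₂ ∈ c → p₃ ∈ c → proj x ∈ c ∧ proj y ∈ c ∧ proj z ∈ c ∧
      (none ∉ c → proj x ≠ proj y ∧ proj x ≠ proj z ∧ proj y ≠ proj z)) :
    ∃! b, b ∈ B ∧ x ∈ b ∧ y ∈ b ∧ z ∈ b := by
  obtain ⟨c, ⟨hc, m1, m2, m3⟩, hu⟩ := hC.cover p₁ p₂ p₃ h12 h13 h23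
  obtain ⟨hx, hy, hz, hn⟩ := h' c hc m1 m2 m3
  obtain ⟨b, ⟨hb, k⟩, hbu⟩ := (hA c hc).cover x y z hx hy hz hxy hxz hyz hn
  refine ⟨b, ⟨(hB b).2 ⟨c, hc, hb⟩, k⟩, ?_⟩
  rintro b' ⟨hb', k'⟩
  obtain ⟨c', hc', hb'⟩ := (hB b').1 hb'
  obtain rfl := hu c' ⟨hc', h c' hc' b' hb' k'.1 k'.2.1 k'.2.2⟩
  exact hbu b' ⟨hb', k'⟩

theorem filling_cover_of_proj_eq {x y z : Option (K × Fin 3)} (hxy : x ≠ y) (hxz : x ≠ z)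
    (hyz : y ≠ z) (h : proj x = proj y) : ∃! b, b ∈ B ∧ x ∈ b ∧ y ∈ b ∧ z ∈ b := by
  have hx0 : proj x ≠ none := fun h0 =>
    hxy ((proj_eq_none.1 h0).trans (proj_eq_none.1 (h ▸ h0)).symm)
  have hn : ∀ c ∈ C, ∀ b ∈ A c, x ∈ b → y ∈ b → none ∈ c := by
    intro c hc b hb hx hy
    by_contra hn
    exact hxy ((hA c hc).injOn hn b hb hx hy h)
  by_cases hz : proj z = none ∨ proj z = proj x
  · obtain ⟨u, hu⟩ := Option.ne_none_iff_exists'.1 hx0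
    have mx : x ∈ fill u := mem_fill.2 (Or.inr hu)
    have my : y ∈ fill u := mem_fill.2 (Or.inr (h ▸ hu))
    have mz : z ∈ fill u := mem_fill.2 (hu ▸ hz)
    obtain ⟨c, hc, h0, hcu⟩ := hC.exists_circle u
    refine ⟨fill u, ⟨(hB _).2 ⟨c, hc, (hA c hc).fill_mem h0 u hcu⟩, mx, my, mz⟩, ?_⟩
    rintro b ⟨hb, kx, ky, kz⟩
    obtain ⟨c', hc', hb⟩ := (hB b).1 hb
    have h0' := hn c' hc' b hb kx ky
    have p := (hA c' hc').proj_mem b hb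
    exact ((hA c' hc').cover x y z (p x kx) (p y ky) (p z kz) hxy hxz hyz
      (fun k => (k h0').elim)).unique ⟨hb, kx, ky, kz⟩
      ⟨(hA c' hc').fill_mem h0' u (hu ▸ p x kx), mx, my, mz⟩
  · push Not at hz
    refine filling_cover_of_span hC hA hB hxy hxz hyz hx0.symm hz.1.symm hz.2.symm ?_ ?_
    · intro c hc b hb kx ky kz
      exact ⟨hn c hc b hb kx ky, (hA c hc).proj_mem b hb x kx, (hA c hc).proj_mem b hb z kz⟩
    · intro c hc k0 kx kz
      exact ⟨kx, h ▸ kx, kz, fun k => (k k0).elim⟩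

theorem filling_cover (x y z : Option (K × Fin 3)) (hxy : x ≠ y) (hxz : x ≠ z) (hyz : y ≠ z) :
    ∃! b, b ∈ B ∧ x ∈ b ∧ y ∈ b ∧ z ∈ b := by
  by_cases h1 : proj x = proj y
  · exact filling_cover_of_proj_eq hC hA hB hxy hxz hyz h1
  by_cases h2 : proj x = proj z
  · simpa only [and_comm, and_left_comm] using
      filling_cover_of_proj_eq hC hA hB hxz hxy hyz.symm h2
  by_cases h3 : proj y = proj z
  · simpa only [and_comm, and_left_comm] using
      filling_cover_of_proj_eq hC hA hB hyz hxy.symm hxz.symm h3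
  · refine filling_cover_of_span hC hA hB hxy hxz hyz h1 h2 h3 ?_ ?_
    · intro c hc b hb kx ky kz
      have p := (hA c hc).proj_mem b hb
      exact ⟨p x kx, p y ky, p z kz⟩
    · intro c hc kx ky kz
      exact ⟨kx, ky, kz, fun _ => ⟨h1, h2, h3⟩⟩

theorem filling_resolution (x : Option (K × Fin 3)) :
    ∃ col : Finset (Option (K × Fin 3)) → Option (Set (Option K) × Fin m),
      ∀ b ∈ B, x ∈ b → ∀ y, x ≠ y → ∃! b', b' ∈ B ∧ x ∈ b' ∧ y ∈ b' ∧ col b' = col b := by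
  classical
  obtain ⟨dir, hdir⟩ := hC.parallel (proj x)
  have h1 : ∀ b, ∃ c, b ∈ B → c ∈ C ∧ b ∈ A c := by
    intro b
    by_cases hb : b ∈ B
    · obtain ⟨c, hc, hbc⟩ := (hB b).1 hb
      exact ⟨c, fun _ => ⟨hc, hbc⟩⟩
    · exact ⟨∅, fun h => (hb h).elim⟩
  choose circ hcirc using h1
  have h2 := fun c (hc : c ∈ C) (hx : proj x ∈ c) => (hA c hc).resolution x hx
  choose! col hsome hnone hne hfill using h2
  let colour : Finset (Option (K × Fin 3)) → Option (Set (Option K) × Fin m) :=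
    fun b => (col (circ b) b).map fun k => (dir (circ b), k)
  have hcolour : ∀ c ∈ C, ∀ b ∈ A c, x ∈ b → colour b = (col c b).map fun k => (dir c, k) := by
    intro c hc b hb hx
    obtain ⟨hc', hb'⟩ := hcirc b ((hB b).2 ⟨c, hc, hb⟩)
    by_cases hf : ∃ u, b = fill u
    · obtain ⟨u, rfl⟩ := hf
      have k : ∀ c ∈ C, fill u ∈ A c → col c (fill u) = none := by
        intro c hc hb
        have p := (hA c hc).proj_mem _ hb
        exact hfill c hc (p x hx) (p none (mem_fill.2 (Or.inl rfl))) u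
          (p (some (u, 0)) (mem_fill.2 (Or.inr rfl))) hx
      simp [colour, k c hc hb, k _ hc' hb']
    · push Not at hf
      rw [circle_eq_of_common_block hC hA hc hc' hb hb' hf]
  have hS : ∀ c ∈ C, proj x ∈ c → ∀ k y, x ≠ y →
      ∃! b, b ∈ B ∧ x ∈ b ∧ y ∈ b ∧ colour b = some (dir c, k) := by
    intro c hc hx k y hxy
    obtain ⟨c', ⟨hc', hx', hs, hd⟩, hu⟩ := hdir c hc hx _ (proj_ne_span hxy)
    obtain ⟨hy, hn⟩ := proj_mem_of_span_mem hx' hs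
    obtain ⟨b, ⟨hb, kx, ky, hk⟩, hbu⟩ := hsome c' hc' hx' y hy hxy hn k
    refine ⟨b, ⟨(hB b).2 ⟨c', hc', hb⟩, kx, ky, ?_⟩, ?_⟩
    · simp only [hcolour c' hc' b hb kx, hk, hd, Option.map_some]
    · rintro b' ⟨hb', kx', ky', hk'⟩
      obtain ⟨c'', hc'', hb''⟩ := (hB b').1 hb'
      rw [hcolour c'' hc'' b' hb'' kx', Option.map_eq_some_iff] at hk'
      obtain ⟨k', hk', e⟩ := hk'
      rw [Prod.mk.injEq] at e
      obtain ⟨e, rfl⟩ := e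
      obtain rfl := hu c'' ⟨hc'', (hA c'' hc'').proj_mem b' hb'' x kx',
        (hA c'' hc'').span_mem hb'' kx' ky' hxy, e⟩
      exact hbu b' ⟨hb'', kx', ky', hk'⟩
  have hN : ∀ y, x ≠ y → ∃! b, b ∈ B ∧ x ∈ b ∧ y ∈ b ∧ colour b = none := by
    intro y hxy
    -- blocks of colour `none` lie above circles through infinity
    have hinf : ∀ c ∈ C, ∀ b ∈ A c, x ∈ b → colour b = none → none ∈ c ∧ col c b = none := by
      intro c hc b hb kx hk
      rw [hcolour c hc b hb kx, Option.map_eq_none_iff] at hk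
      refine ⟨?_, hk⟩
      by_contra hn
      exact hne c hc ((hA c hc).proj_mem b hb x kx) hn b hk
    by_cases hf : ∃ u, x ∈ fill u ∧ y ∈ fill u
    · obtain ⟨u, mx, my⟩ := hf
      obtain ⟨c, hc, h0, hcu⟩ := hC.exists_circle u
      have hxc : ∀ c : Set (Option K), none ∈ c → some u ∈ c → proj x ∈ c := by
        intro c h0 hu
        rcases mem_fill.1 mx with e | e <;> rw [e] <;> assumption
      have hb := (hA c hc).fill_mem h0 u hcu
      refine ⟨fill u, ⟨(hB _).2 ⟨c, hc, hb⟩, mx, my, ?_⟩, ?_⟩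
      · rw [hcolour c hc _ hb mx, hfill c hc (hxc c h0 hcu) h0 u hcu mx, Option.map_none]
      · rintro b ⟨hb, kx, ky, hk⟩
        obtain ⟨c', hc', hb'⟩ := (hB b).1 hb
        obtain ⟨h0', hk'⟩ := hinf c' hc' b hb' kx hk
        have p := (hA c' hc').proj_mem b hb'
        have hu' : some u ∈ c' := by
          rcases mem_fill.1 mx with e | e
          · rcases mem_fill.1 my with e' | e'
            · exact (hxy ((proj_eq_none.1 e).trans (proj_eq_none.1 e').symm)).elim
            · exact e' ▸ p y ky
          · exact e ▸ p x kx
        exact (hnone c' hc' (p x kx) h0' y (p y ky) hxy).unique ⟨hb', kx, ky, hk'⟩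
          ⟨(hA c' hc').fill_mem h0' u hu', mx, my, hfill c' hc' (p x kx) h0' u hu' mx⟩
    · have hx0 : proj x ≠ none := by
        intro e
        rcases hy : proj y with _ | u
        · exact hxy ((proj_eq_none.1 e).trans (proj_eq_none.1 hy).symm)
        · exact hf ⟨u, mem_fill.2 (Or.inl e), mem_fill.2 (Or.inr hy)⟩
      obtain ⟨u, hu⟩ := Option.ne_none_iff_exists'.1 hx0
      have hy : proj y ≠ none ∧ proj y ≠ some u := by
        by_contra! h
        refine hf ⟨u, mem_fill.2 (Or.inr hu), mem_fill.2 ?_⟩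
        by_cases e : proj y = none
        · exact Or.inl e
        · exact Or.inr (h e)
      obtain ⟨c, ⟨hc, h0, hcx, hcy⟩, hcu⟩ := hC.cover none (proj x) (proj y) hx0.symm hy.1.symm
        (hu ▸ hy.2.symm)
      obtain ⟨b, ⟨hb, kx, ky, hk⟩, hbu⟩ := hnone c hc hcx h0 y hcy hxy
      refine ⟨b, ⟨(hB b).2 ⟨c, hc, hb⟩, kx, ky, ?_⟩, ?_⟩
      · rw [hcolour c hc b hb kx, hk, Option.map_none]
      · rintro b' ⟨hb', kx', ky', hk'⟩
        obtain ⟨c', hc', hb'⟩ := (hB b').1 hb'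
        obtain ⟨h0', hk'⟩ := hinf c' hc' b' hb' kx' hk'
        have p := (hA c' hc').proj_mem b' hb'
        obtain rfl := hcu c' ⟨hc', h0', p x kx', p y ky'⟩
        exact hbu b' ⟨hb', kx', ky', hk'⟩
  refine ⟨colour, fun b hb kx y hxy => ?_⟩
  obtain ⟨c, hc, hb⟩ := (hB b).1 hb
  rw [hcolour c hc b hb kx]
  cases col c b with
  | none => exact hN y hxy
  | some k => exact hS c hc ((hA c hc).proj_mem b hb x kx) k y hxy

end

theorem exists_isRDSQS_of_fillings [Fintype K] [Nontrivial K] (hC : IsCircleGeometry q C)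
    (hA : ∀ c ∈ C, IsCircleFilling m c (A c)) :
    ∃ B : Finset (Finset (Option (K × Fin 3))), IsRDSQS (3 * Fintype.card K + 1) univ B := by
  classical
  let B : Finset (Finset (Option (K × Fin 3))) := {b | ∃ c ∈ C, b ∈ A c}
  have hB : ∀ b, b ∈ B ↔ ∃ c ∈ C, b ∈ A c := fun b => by simp [B]
  refine ⟨B, ?_⟩
  have := isRDSQS_of_colouring (B := B)
    (fun b hb => by
      obtain ⟨c, hc, hb⟩ := (hB b).1 hb
      exact (hA c hc).card_block b hb)
    (filling_cover hC hA hB) (filling_resolution hC hA hB)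
  rwa [Fintype.card_option, Fintype.card_prod, Fintype.card_fin, mul_comm] at this

end Filling

theorem existsUnique_mem_map_iff {α β : Type*} (f : α ↪ β) (D : Finset (Finset α))
    (p : Finset β → Prop) :
    (∃! b, b ∈ D.map (mapEmbedding f).toEmbedding ∧ p b) ↔ ∃! b, b ∈ D ∧ p (b.map f) := by
  constructor
  · rintro ⟨b, ⟨hb, hp⟩, hu⟩
    obtain ⟨b, hb', rfl⟩ := mem_map.1 hb
    refine ⟨b, ⟨hb', hp⟩, fun c ⟨hc, hpc⟩ => ?_⟩
    exact (mapEmbedding f).injective (hu (c.map f) ⟨mem_map.2 ⟨c, hc, rfl⟩, hpc⟩)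
  · rintro ⟨b, ⟨hb, hp⟩, hu⟩
    refine ⟨b.map f, ⟨mem_map.2 ⟨b, hb, rfl⟩, hp⟩, ?_⟩
    rintro _ ⟨hc, hpc⟩
    obtain ⟨c, hc', rfl⟩ := mem_map.1 hc
    rw [← hu c ⟨hc', hpc⟩]
    rfl

section

variable {α : Type*} {m : ℕ} {B : Finset (Finset α)}

theorem IsResolvableHDesign.card_colour_class [Fintype α] [DecidableEq α] {q : ℕ}
    (h : IsResolvableHDesign (id : α → α) m B) (hα : Fintype.card α = 3 * q + 1) {x : α}
    {T : Finset (Finset α)} (hT : ∀ b ∈ T, b ∈ B ∧ x ∈ b)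
    (hu : ∀ y, x ≠ y → ∃! b, b ∈ T ∧ y ∈ b) : #T = q := by
  have h1 : T.biUnion (fun b => b.erase x) = univ.erase x := by
    ext y
    simp only [mem_biUnion, mem_erase, mem_univ, and_true]
    constructor
    · rintro ⟨b, -, hy, -⟩
      exact hy
    · intro hy
      obtain ⟨b, ⟨hb, hyb⟩, -⟩ := hu y hy.symm
      exact ⟨b, hb, hy, hyb⟩
  have h2 : #(T.biUnion fun b => b.erase x) = ∑ b ∈ T, #(b.erase x) := by
    refine card_biUnion fun b hb c hc hbc => disjoint_left.2 fun y hy hy' => hbc ?_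
    rw [mem_erase] at hy hy'
    exact (hu y hy.1.symm).unique ⟨hb, hy.2⟩ ⟨hc, hy'.2⟩
  have h3 : ∑ b ∈ T, #(b.erase x) = ∑ b ∈ T, 3 :=
    sum_congr rfl fun b hb => by rw [card_erase_of_mem (hT b hb).2, h.card_block b (hT b hb).1]
  rw [h1, h3, card_erase_of_mem (mem_univ _), card_univ, hα, sum_const, smul_eq_mul] at h2
  omega

/-- The points of a quadruple system with resolvable derived designs can be labelled such that the
quadruples `fill u` form a parallel class of the derived design at infinity. -/
theorem IsResolvableHDesign.exists_equiv [Fintype α] [DecidableEq α] {ι : Type*} [Fintype ι]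
    [DecidableEq ι] {x : α} {T : Finset (Finset α)} (h : IsResolvableHDesign (id : α → α) m B)
    (hα : Fintype.card α = 3 * Fintype.card ι + 1) (hT : ∀ b ∈ T, b ∈ B ∧ x ∈ b)
    (hu : ∀ y, x ≠ y → ∃! b, b ∈ T ∧ y ∈ b) :
    ∃ e : Option (ι × Fin 3) ≃ α, e none = x ∧ ∀ u, (fill u).map e.toEmbedding ∈ T := by
  obtain ⟨f⟩ : Nonempty (ι ≃ T) := by
    rw [← Fintype.card_eq, Fintype.card_coe, h.card_colour_class hα hT hu]
  have hcard : ∀ b : T, #((b : Finset α).erase x) = 3 := fun b => by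
    rw [card_erase_of_mem (hT b b.2).2, h.card_block b (hT b b.2).1]
  let g : ∀ b : T, Fin 3 ≃ (b : Finset α).erase x := fun b => (equivFinOfCardEq (hcard b)).symm
  let F : Option (ι × Fin 3) → α := fun w => w.elim x fun p => (g (f p.1) p.2 : α)
  have hF : ∀ u j, F (some (u, j)) ≠ x ∧ F (some (u, j)) ∈ (f u : Finset α) := fun u j =>
    mem_erase.1 (g (f u) j).2
  have hinj : Function.Injective F := by
    rintro (_ | ⟨u, i⟩) (_ | ⟨v, j⟩) e
    · rfl
    · exact ((hF v j).1 e.symm).elim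
    · exact ((hF u i).1 e).elim
    · have huv : u = v := f.injective (Subtype.ext ((hu _ (hF u i).1.symm).unique
        ⟨(f u).2, (hF u i).2⟩ ⟨(f v).2, e ▸ (hF v j).2⟩))
      subst huv
      obtain rfl := (g (f u)).injective (Subtype.ext e)
      rfl
  have hbij : Function.Bijective F := by
    rw [Fintype.bijective_iff_injective_and_card]
    refine ⟨hinj, ?_⟩
    rw [Fintype.card_option, Fintype.card_prod, Fintype.card_fin, hα, mul_comm]
  refine ⟨Equiv.ofBijective F hbij, rfl, fun u => ?_⟩
  have : (fill u).map (Equiv.ofBijective F hbij).toEmbedding = (f u : Finset α) := by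
    refine eq_of_subset_of_card_le ?_ ?_
    · intro y hy
      obtain ⟨w, hw, rfl⟩ := mem_map.1 hy
      rcases w with _ | ⟨v, j⟩
      · exact (hT _ (f u).2).2
      · obtain rfl : v = u := by simpa [mem_fill, proj] using hw
        exact (hF v j).2
    · rw [card_map, card_fill, h.card_block _ (hT _ (f u).2).1]
  rw [this]
  exact (f u).2

theorem IsResolvableHDesign.exists_with_fills [Fintype α] [DecidableEq α] [Nonempty α]
    {ι : Type*} [Fintype ι] [DecidableEq ι] (h : IsResolvableHDesign (id : α → α) (m + 1) B)
    (hα : Fintype.card α = 3 * Fintype.card ι + 1) :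
    ∃ D : Finset (Finset (Option (ι × Fin 3))),
      IsResolvableHDesign (id : Option (ι × Fin 3) → _) (m + 1) D ∧ (∀ u, fill u ∈ D) ∧
      ∀ x, ∃ col : Finset (Option (ι × Fin 3)) → Option (Fin m),
        (∀ y, x ≠ y → ∀ k, ∃! b, b ∈ D ∧ x ∈ b ∧ y ∈ b ∧ col b = k) ∧
        ∀ u, x ∈ fill u → col (fill u) = none := by
  obtain ⟨x₀⟩ := ‹Nonempty α›
  obtain ⟨col₀, hcol₀⟩ := h.resolution x₀
  let T : Finset (Finset α) := {b ∈ B | x₀ ∈ b ∧ col₀ b = 0}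
  have hT : ∀ b, b ∈ T ↔ b ∈ B ∧ x₀ ∈ b ∧ col₀ b = 0 := fun b => mem_filter
  obtain ⟨e, rfl, he⟩ := h.exists_equiv (ι := ι) (x := x₀) (T := T) hα
    (fun b hb => ⟨((hT b).1 hb).1, ((hT b).1 hb).2.1⟩)
    (fun y hy => by
      have := hcol₀ y hy 0
      simp only [hT]
      simpa only [and_assoc, and_comm, and_left_comm] using this)
  have hD := h.map e.symm (ρ := id) (fun x y => by simp)
  have hfill : ∀ u, fill u ∈ B.map (mapEmbedding e.symm.toEmbedding).toEmbedding := by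
    intro u
    refine mem_map.2 ⟨(fill u).map e.toEmbedding, ((hT _).1 (he u)).1, ?_⟩
    ext w
    simp [mapEmbedding_apply]
  refine ⟨_, hD, hfill, fun x => ?_⟩
  have key : ∃ (col : Finset (Option (ι × Fin 3)) → Fin (m + 1)) (k₀ : Fin (m + 1)),
      (∀ y, x ≠ y → ∀ k, ∃! b, b ∈ B.map (mapEmbedding e.symm.toEmbedding).toEmbedding ∧
        x ∈ b ∧ y ∈ b ∧ col b = k) ∧ ∀ u, x ∈ fill u → col (fill u) = k₀ := by
    rcases x with _ | ⟨v, j⟩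
    · refine ⟨fun b => col₀ (b.map e.toEmbedding), 0, fun y hy k => ?_, fun u _ =>
        ((hT _).1 (he u)).2.2⟩
      have h1 := hcol₀ (e y) (fun h => hy (e.injective h)) k
      rw [existsUnique_mem_map_iff]
      have h2 : ∀ b : Finset α, (b.map e.symm.toEmbedding).map e.toEmbedding = b := by
        intro b; ext; simp
      have h3 : ∀ (b : Finset α) w, w ∈ b.map e.symm.toEmbedding ↔ e w ∈ b := by
        intro b w; simp
      simpa only [h2, h3] using h1
    · obtain ⟨col, hcol⟩ := hD.resolution (some (v, j))
      refine ⟨col, col (fill v), hcol, fun u hu => ?_⟩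
      obtain rfl : v = u := by simpa [mem_fill, proj] using hu
      rfl
  obtain ⟨col, k₀, h1, h2⟩ := key
  let σ : Fin (m + 1) ≃ Option (Fin m) := (Equiv.swap k₀ 0).trans (finSuccEquiv m)
  refine ⟨fun b => σ (col b), fun y hy k => ?_, fun u hu => ?_⟩
  · have := h1 y hy (σ.symm k)
    simpa only [Equiv.eq_symm_apply] using this
  · simp [h2 u hu, σ]

end

section

variable {K : Type*} [DecidableEq K] {m : ℕ} {c : Set (Option K)}

theorem exists_circleFilling_of_notMem [Fintype {u : K // some u ∈ c}] (hc : none ∉ c)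
    {D : Finset (Finset ({u : K // some u ∈ c} × Fin 3))}
    (h : IsResolvableHDesign Prod.fst m D) : ∃ A, IsCircleFilling m c A := by
  let f : {u : K // some u ∈ c} × Fin 3 ↪ Option (K × Fin 3) :=
    ⟨fun p => some (p.1, p.2), by rintro ⟨⟨u, hu⟩, i⟩ ⟨⟨v, hv⟩, j⟩ e; simpa using e⟩
  have hproj : ∀ p, proj (f p) = some p.1.1 := fun p => rfl
  have hpp : ∀ p p', proj (f p) = proj (f p') ↔ p.1 = p'.1 := fun p p' => by
    rw [hproj, hproj, Option.some_inj, Subtype.ext_iff]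
  have hsurj : ∀ w, proj w ∈ c → ∃ p, f p = w := by
    rintro (_ | ⟨u, j⟩) hw
    · exact (hc hw).elim
    · exact ⟨(⟨u, hw⟩, j), rfl⟩
  refine ⟨D.map (mapEmbedding f).toEmbedding, ?_, ?_, ?_, fun h0 => (hc h0).elim, ?_, ?_⟩
  · intro b hb
    obtain ⟨b, hb', rfl⟩ := mem_map.1 hb
    simpa using h.card_block b hb'
  · intro b hb w hw
    obtain ⟨b, hb', rfl⟩ := mem_map.1 hb
    obtain ⟨p, hp, rfl⟩ := mem_map.1 hw
    exact p.1.2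
  · intro _ b hb w hw w' hw' e
    obtain ⟨b, hb', rfl⟩ := mem_map.1 hb
    obtain ⟨p, hp, rfl⟩ := mem_map.1 hw
    obtain ⟨p', hp', rfl⟩ := mem_map.1 hw'
    rw [h.injOn_block b hb' hp hp' ((hpp _ _).1 e)]
  · intro x y z hx hy hz _ _ _ hn
    obtain ⟨x, rfl⟩ := hsurj x hx
    obtain ⟨y, rfl⟩ := hsurj y hy
    obtain ⟨z, rfl⟩ := hsurj z hz
    simp only [Ne, hpp] at hn
    rw [existsUnique_mem_map_iff]
    simp only [mem_map' f]
    exact h.cover x y z (hn hc).1 (hn hc).2.1 (hn hc).2.2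
  · intro x hx
    obtain ⟨x, rfl⟩ := hsurj x hx
    obtain ⟨col, hcol⟩ := h.resolution x
    refine ⟨fun b => some (col (b.preimage f f.injective.injOn)), fun y hy _ hn k => ?_,
      fun h0 => (hc h0).elim, fun _ b => by simp, fun h0 => (hc h0).elim⟩
    obtain ⟨y, rfl⟩ := hsurj y hy
    rw [existsUnique_mem_map_iff]
    simp only [mem_map' f, preimage_map, Option.some_inj]
    exact hcol y (fun e => hn hc ((hpp _ _).2 e)) k

theorem exists_circleFilling_of_mem [Fintype {u : K // some u ∈ c}] (hc : none ∈ c)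
    {D : Finset (Finset (Option ({u : K // some u ∈ c} × Fin 3)))}
    (h : IsResolvableHDesign (id : Option ({u : K // some u ∈ c} × Fin 3) → _) (m + 1) D)
    (hfill : ∀ u, fill u ∈ D)
    (hres : ∀ x, ∃ col : Finset (Option ({u : K // some u ∈ c} × Fin 3)) → Option (Fin m),
        (∀ y, x ≠ y → ∀ k, ∃! b, b ∈ D ∧ x ∈ b ∧ y ∈ b ∧ col b = k) ∧
        ∀ u, x ∈ fill u → col (fill u) = none) :
    ∃ A, IsCircleFilling m c A := by
  let f : Option ({u : K // some u ∈ c} × Fin 3) ↪ Option (K × Fin 3) :=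
    ⟨Option.map (Prod.map Subtype.val id),
      Option.map_injective (Subtype.val_injective.prodMap Function.injective_id)⟩
  have hproj : ∀ p, proj (f p) ∈ c := by
    rintro (_ | ⟨u, j⟩)
    · exact hc
    · exact u.2
  have hsurj : ∀ w, proj w ∈ c → ∃ p, f p = w := by
    rintro (_ | ⟨u, j⟩) hw
    · exact ⟨none, rfl⟩
    · exact ⟨some (⟨u, hw⟩, j), rfl⟩
  have hff : ∀ u, (fill u).map f = fill u.1 := by
    intro u
    refine eq_of_subset_of_card_le (fun w hw => ?_) (by rw [card_map, card_fill, card_fill])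
    obtain ⟨p, hp, rfl⟩ := mem_map.1 hw
    rw [mem_fill] at hp ⊢
    rcases p with _ | ⟨v, j⟩
    · exact Or.inl rfl
    · obtain rfl : v = u := by simpa [proj] using hp
      exact Or.inr rfl
  refine ⟨D.map (mapEmbedding f).toEmbedding, ?_, ?_, fun h0 => (h0 hc).elim, ?_, ?_, ?_⟩
  · intro b hb
    obtain ⟨b, hb', rfl⟩ := mem_map.1 hb
    simpa using h.card_block b hb'
  · intro b hb w hw
    obtain ⟨b, hb', rfl⟩ := mem_map.1 hb
    obtain ⟨p, hp, rfl⟩ := mem_map.1 hw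
    exact hproj p
  · intro _ u hu
    rw [← hff ⟨u, hu⟩]
    exact mem_map.2 ⟨_, hfill ⟨u, hu⟩, rfl⟩
  · intro x y z hx hy hz hxy hxz hyz _
    obtain ⟨x, rfl⟩ := hsurj x hx
    obtain ⟨y, rfl⟩ := hsurj y hy
    obtain ⟨z, rfl⟩ := hsurj z hz
    rw [existsUnique_mem_map_iff]
    simp only [mem_map' f]
    exact h.cover x y z (fun e => hxy (congrArg f e)) (fun e => hxz (congrArg f e))
      (fun e => hyz (congrArg f e))
  · intro x hx
    obtain ⟨x, rfl⟩ := hsurj x hx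
    obtain ⟨col, hcol, hnone⟩ := hres x
    have key : ∀ y, proj y ∈ c → f x ≠ y → ∀ k, ∃! b,
        b ∈ D.map (mapEmbedding f).toEmbedding ∧ f x ∈ b ∧ y ∈ b ∧
          col (b.preimage f f.injective.injOn) = k := by
      intro y hy hxy k
      obtain ⟨y, rfl⟩ := hsurj y hy
      rw [existsUnique_mem_map_iff]
      simp only [mem_map' f, preimage_map]
      exact hcol y (fun e => hxy (congrArg f e)) k
    refine ⟨fun b => col (b.preimage f f.injective.injOn), fun y hy hxy _ k => key y hy hxy _,
      fun _ y hy hxy => key y hy hxy _, fun h0 => (h0 hc).elim, fun _ u hu hxu => ?_⟩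
    rw [← hff ⟨u, hu⟩, mem_map' f] at hxu
    simp only [← hff ⟨u, hu⟩, preimage_map]
    exact hnone _ hxu

end

/-- The recursive construction: a circle geometry over `K`, an `RDSQS(3q + 1)` and an `H`-design
with `q + 1` groups of size three yield an `RDSQS(3|K| + 1)`. -/
theorem exists_isRDSQS_of_circleGeometry {K : Type*} [Fintype K] [Nontrivial K] [DecidableEq K]
    {q m : ℕ} {C : Set (Set (Option K))} (hC : IsCircleGeometry q C)
    {S : Finset (Finset (Fin (3 * q + 1)))}
    (hS : IsResolvableHDesign (id : Fin (3 * q + 1) → _) (m + 1) S)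
    {H : Finset (Finset (Fin (q + 1) × Fin 3))}
    (hH : IsResolvableHDesign (Prod.fst : Fin (q + 1) × Fin 3 → _) m H) :
    ∃ B : Finset (Finset (Option (K × Fin 3))), IsRDSQS (3 * Fintype.card K + 1) univ B := by
  classical
  have hA : ∀ c ∈ C, ∃ A, IsCircleFilling m c A := by
    intro c hc
    have hcard := hC.ncard_circle c hc
    have himg : c \ {none} = some '' {u : K | some u ∈ c} := by
      ext x
      cases x <;> simp
    have hι : (c \ {none}).ncard = Fintype.card {u : K // some u ∈ c} := by
      rw [himg, Set.ncard_image_of_injective _ (Option.some_injective K),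
        ← Nat.card_coe_set_eq, Nat.card_eq_fintype_card]
      rfl
    by_cases h0 : none ∈ c
    · rw [Set.ncard_sdiff_singleton_of_mem h0, hcard, Nat.add_sub_cancel] at hι
      obtain ⟨D, hD, hf, hr⟩ := hS.exists_with_fills (ι := {u : K // some u ∈ c})
        (by rw [Fintype.card_fin, ← hι])
      exact exists_circleFilling_of_mem h0 hD hf hr
    · rw [Set.sdiff_singleton_eq_self h0, hcard] at hι
      let e : Fin (q + 1) ≃ {u : K // some u ∈ c} := (Fintype.equivFinOfCardEq hι.symm).symm
      exact exists_circleFilling_of_notMem h0 (hH.map (e.prodCongr (Equiv.refl _))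
        (ρ := Prod.fst) (fun x y => by simp))
  choose! A hA using hA
  exact exists_isRDSQS_of_fillings hC hA

namespace OrbitPresentation

theorem exists_quadrupleSystem {d : OrbitPresentation} (h : d.check = true) {q m : ℕ}
    (hN : d.N = 3 * q + 1) (hk : d.k = d.N) (hm : d.m = m + 1) :
    ∃ S, IsResolvableHDesign (id : Fin (3 * q + 1) → _) (m + 1) S := by
  have := (isResolvableHDesign_of_check h (by omega)).map (finCongr hN) (ρ := id) (fun x y => by
    rw [group, group, hk, Nat.mod_eq_of_lt x.2, Nat.mod_eq_of_lt y.2, id, id,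
      EmbeddingLike.apply_eq_iff_eq, Fin.ext_iff])
  exact ⟨_, hm ▸ this⟩

theorem exists_hDesign {d : OrbitPresentation} (h : d.check = true) {k m : ℕ}
    (hN : d.N = 3 * k) (hk : d.k = k) (hm : d.m = m) (hm0 : 0 < m) :
    ∃ H, IsResolvableHDesign (Prod.fst : Fin k × Fin 3 → _) m H := by
  subst hm
  exact ⟨_, (isResolvableHDesign_of_check h hm0).map
    (((finCongr hN).trans finProdFinEquiv.symm).trans (Equiv.prodComm _ _))
    (ρ := Prod.fst) (fun x y => by
      simp [group, hk, finProdFinEquiv, Fin.ext_iff])⟩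

end OrbitPresentation

theorem exists_isRDSQS_four :
    ∃ B : Finset (Finset (Fin 4)), IsRDSQS 4 univ B := by
  refine ⟨{univ}, isRDSQS_of_colouring (κ := Unit) (by simp) (fun x y z _ _ _ => ⟨univ, by simp⟩)
    fun x => ⟨fun _ => (), fun b _ _ y _ => ⟨univ, by simp⟩⟩⟩

/-- From an `RDSQS(3p + 1)` and an `H`-design with `p + 1` groups of size three, `p` prime, one
obtains an `RDSQS(3pⁿ + 1)` for all `n`. -/
theorem exists_isRDSQS_prime_pow {p m : ℕ} [Fact p.Prime]
    (hS : ∃ S, IsResolvableHDesign (id : Fin (3 * p + 1) → _) (m + 1) S)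
    (hH : ∃ H, IsResolvableHDesign (Prod.fst : Fin (p + 1) × Fin 3 → _) m H) (n : ℕ) :
    ∃ (α : Type) (_ : DecidableEq α) (X : Finset α) (B : Finset (Finset α)),
      IsRDSQS (3 * p ^ n + 1) X B := by
  classical
  rcases eq_or_ne n 0 with rfl | hn
  · obtain ⟨B, hB⟩ := exists_isRDSQS_four
    exact ⟨Fin 4, inferInstance, univ, B, by simpa using hB⟩
  · obtain ⟨S, hS⟩ := hS
    obtain ⟨H, hH⟩ := hH
    let K := GaloisField p n
    have : Fintype K := Fintype.ofFinite K
    have hC : IsCircleGeometry p (circles K (ZMod p) : Set (Set (Option K))) := by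
      have := isCircleGeometry_circles (K := K) (ZMod p)
      rwa [Nat.card_zmod] at this
    obtain ⟨B, hB⟩ := exists_isRDSQS_of_circleGeometry hC hS hH
    rw [← Nat.card_eq_fintype_card, GaloisField.card p n hn] at hB
    exact ⟨_, _, univ, B, hB⟩

theorem mainTheorem3 (n : ℕ) :
    (∃ (α : Type) (_ : DecidableEq α) (X : Finset α) (B : Finset (Finset α)),
      IsRDSQS (3 * 7 ^ n + 1) X B) ∧
    (∃ (α : Type) (_ : DecidableEq α) (X : Finset α) (B : Finset (Finset α)),
      IsRDSQS (3 * 13 ^ n + 1) X B) := by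
  have : Fact (Nat.Prime 7) := ⟨by norm_num⟩
  have : Fact (Nat.Prime 13) := ⟨by norm_num⟩
  exact ⟨exists_isRDSQS_prime_pow (m := 9)
      (OrbitPresentation.exists_quadrupleSystem
        OrbitPresentation.check_quadrupleSystem22 rfl rfl rfl)
      (OrbitPresentation.exists_hDesign
        OrbitPresentation.check_hDesignEight rfl rfl rfl (by norm_num)) n,
    exists_isRDSQS_prime_pow (m := 18)
      (OrbitPresentation.exists_quadrupleSystem
        OrbitPresentation.check_quadrupleSystem40 rfl rfl rfl)
      (OrbitPresentation.exists_hDesign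
        OrbitPresentation.check_hDesignFourteen rfl rfl rfl (by norm_num)) n⟩
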